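/- Let $\mu\in\mathbb R$ and $\alpha,\beta\in\mathbb R^d$, write $D_y=-i\partial_y$ and $L=\beta\cdot y-\alpha\cdot D_y$, so that $e^{isL}\varphi(y)=e^{-is^2\alpha\cdot\beta/2}\,e^{is\beta\cdot y}\,\varphi(y-s\alpha)$. For $\varphi\in\mathcal S(\mathbb R^d)$ let $$\mathcal T_{\mu,\alpha,\beta}\varphi=\int_{-\infty}^{+\infty}e^{i\mu s^2}e^{isL}\varphi\,ds=\lim_{R\to\infty}\int_{-R}^{R}e^{i\mu s^2}e^{isL}\varphi\,ds$$ as a limit in the sense of tempered distributions. Square roots below are principal. (1) $\mathcal T_{\mu,\alpha,\beta}$ maps $\mathcal S(\mathbb R^d)$ into itself (i.e. for every $\varphi\in\mathcal S(\mathbb R^d)$ the limit exists and is a Schwartz function) if and only if $\mu\neq0$. (2) Let $\mu\ne0$. There is a unique strongly continuous one-parameter unitary group $e^{-itL^2}$ on $L^2(\mathbb R^d)$ whose derivative at $t=0$ on $\mathcal S(\mathbb R^d)$ is $-iL^2$, and for all $\varphi\in\mathcal S(\mathbb R^d)$ $$\mathcal T_{\mu,\alpha,\beta}\varphi=\sqrt{\frac{i\pi}{\mu}}\;e^{-\frac{i}{4\mu}(\beta\cdot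 y-\alpha\cdot D_y)^2}\varphi ,$$ the limit defining $\mathcal T_{\mu,\alpha,\beta}\varphi$ holding also pointwise on $\mathbb R^d$. The operator $e^{-\frac{i}{4\mu}L^2}$ is a metaplectic transformation associated with the matrix $\Phi_{\alpha,\beta}(\tfrac1{4\mu})$, where $$\Phi_{\alpha,\beta}(t)=\begin{pmatrix}\mathbb I-2t\,\alpha\beta^{T}&2t\,\alpha\alpha^{T}\\-2t\,\beta\beta^{T}&\mathbb I+2t\,\beta\alpha^{T}\end{pmatrix}$$ is the linear Hamiltonian flow of $(\beta\cdot y-\alpha\cdot\eta)^2$. Here $M$ is a metaplectic transformation associated with $F$ if, for some smooth family $S(t)$ of real symmetric $2d\times2d$ matrices and some $t_0,t_1\in\mathbb R$, $F=G(t_1)$ with $\dot G=JSG$, $G(t_0)=\mathbb I$, $J=\begin{pmatrix}0&\mathbb I\\-\mathbb I&0\end{pmatrix}$, and $M$ is the unitary propagator from $t_0$ to $t_1$ of $i\partial_tu={\rm op}^w_1(\tfrac12S(t)z\cdot z)u$. (3) Let $\mu\neq0$, let $\Gamma$ be a complex symmetric $d\times d$ matrix with positive definite imaginary part ($\Gamma\in\mathfrak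 S^+(d)$), and put $g^\Gamma(x)=c_\Gamma e^{\frac i2\Gamma x\cdot x}$ with $|c_\Gamma|=\pi^{-d/4}\det(\mathrm{Im}\,\Gamma)^{1/4}$. Then $2\mu-\alpha\cdot\beta+\alpha\cdot\Gamma\alpha\ne0$, the matrix $$\Gamma'=\Gamma-\frac{(\beta-\Gamma\alpha)(\beta-\Gamma\alpha)^{T}}{2\mu-\alpha\cdot\beta+\alpha\cdot\Gamma\alpha}$$ belongs to $\mathfrak S^+(d)$, and for every complex polynomial function $A$ on $\mathbb R^{2d}$ the function ${\rm op}^w_1(A)g^\Gamma$ is a Schwartz function with $$\mathcal T_{\mu,\alpha,\beta}\big({\rm op}^w_1(A)g^\Gamma\big)=\sqrt{\frac{i\pi}{\mu}}\;{\rm op}^w_1\big(A\circ\Phi_{\alpha,\beta}(-\tfrac1{4\mu})\big)g^{\Gamma'},$$ where the normalization constant of $g^{\Gamma'}$ is $c_{\Gamma'}=c_\Gamma\Big(\dfrac{2\mu-\alpha\cdot\beta+\alpha\cdot\Gamma\alpha}{2\mu}\Big)^{-1/2}$, and indeed $|c_{\Gamma'}|=\pi^{-d/4}\det(\mathrm{Im}\,\Gamma')^{1/4}$.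 Here ${\rm op}^w_1(a)f(x)=(2\pi)^{-d}\int\!\int a(\tfrac{x+y}2,\xi)e^{i\xi\cdot(x-y)}f(y)\,dy\,d\xi$. -/

import Mathlib

open MeasureTheory Filter Topology
open scoped SchwartzMap ContDiff

noncomputable section

namespace TransferOp

/-- The Euclidean space `ℝ^d`. -/
abbrev E (d : ℕ) : Type := EuclideanSpace ℝ (Fin d)

/-- The Hilbert space `L²(ℝ^d)` of complex-valued functions. -/
abbrev L2 (d : ℕ) : Type := Lp ℂ 2 (volume : Measure (E d))

/-- The class in `L²` of a Schwartz function. -/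
def toL2 {d : ℕ} (φ : 𝓢(E d, ℂ)) : L2 d := φ.toLp 2 volume

/-- Indices of phase space coordinates `z = (y, η)`: `inl` for position, `inr` for momentum. -/
abbrev PhIdx (d : ℕ) : Type := Fin d ⊕ Fin d

/-! ### The operator `β·y - α·D_y` and its exponentials -/

/-- The first order operator `β·y - α·D_y`, where `D_y = -i ∂_y`. -/
def linOp {d : ℕ} (α β : E d) (f : E d → ℂ) : E d → ℂ := fun y =>
  ((inner ℝ β y : ℝ) : ℂ) * f y - (-Complex.I) * fderiv ℝ f y α

/-- The unitary operator `exp(i s (β·y - α·D_y))`; see `hasDerivAt_expLin`. -/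
def expLin {d : ℕ} (α β : E d) (s : ℝ) (f : E d → ℂ) : E d → ℂ := fun y =>
  Complex.exp (-(Complex.I * ((s ^ 2 * inner ℝ α β / 2 : ℝ) : ℂ))) *
    Complex.exp (Complex.I * ((s * inner ℝ β y : ℝ) : ℂ)) * f (y - s • α)

theorem expLin_zero {d : ℕ} (α β : E d) (f : E d → ℂ) : expLin α β 0 f = f := by
  funext y
  simp [expLin]

/-- `s ↦ exp(i s L) f` solves `∂_s F = i L F` with `L = β·y - α·D_y`. -/
theorem hasDerivAt_expLin {d : ℕ} (α β : E d) (f : E d → ℂ) (hf : Differentiable ℝ f)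
    (s : ℝ) (y : E d) :
    HasDerivAt (fun r : ℝ => expLin α β r f y)
      (Complex.I * linOp α β (expLin α β s f) y) s := by
  have hfd : HasFDerivAt f (fderiv ℝ f (y - s • α)) (y - s • α) := (hf _).hasFDerivAt
  -- derivative in the group parameter
  have hA : HasDerivAt (fun r : ℝ => ((r ^ 2 * inner ℝ α β / 2 : ℝ) : ℂ))
      ((s * inner ℝ α β : ℝ) : ℂ) s := by
    apply HasDerivAt.ofReal_comp
    have := (((hasDerivAt_id s).pow 2).mul_const (inner ℝ α β)).div_const 2
    refine this.congr_deriv ?_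
    simp only [id_eq, Nat.cast_ofNat]
    ring
  have hB : HasDerivAt (fun r : ℝ => ((r * inner ℝ β y : ℝ) : ℂ))
      ((inner ℝ β y : ℝ) : ℂ) s := by
    apply HasDerivAt.ofReal_comp
    simpa using (hasDerivAt_id s).mul_const (inner ℝ β y)
  have hl : HasDerivAt (fun r : ℝ => y - r • α) (-α) s := by
    simpa using ((hasDerivAt_id s).smul_const α).const_sub y
  have hC : HasDerivAt (fun r : ℝ => f (y - r • α)) (fderiv ℝ f (y - s • α) (-α)) s :=
    hfd.comp_hasDerivAt s hl
  have hs := (((hA.const_mul Complex.I).neg.cexp).mul ((hB.const_mul Complex.I).cexp)).mul hC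
  -- derivative in the space variable
  have hB' : HasFDerivAt (fun x : E d => ((s * inner ℝ β x : ℝ) : ℂ))
      (Complex.ofRealCLM.comp (s • innerSL ℝ β)) y := by
    exact (Complex.ofRealCLM.comp (s • innerSL ℝ β)).hasFDerivAt (x := y)
  have hl' : HasFDerivAt (fun x : E d => x - s • α) (ContinuousLinearMap.id ℝ (E d)) y :=
    (hasFDerivAt_id y).sub_const _
  have hC' : HasFDerivAt (fun x : E d => f (x - s • α)) (fderiv ℝ f (y - s • α)) y :=
    (HasFDerivAt.comp y hfd hl').congr_fderiv (ContinuousLinearMap.comp_id _)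
  have hy := ((hB'.const_mul Complex.I).cexp.const_mul
    (Complex.exp (-(Complex.I * ((s ^ 2 * inner ℝ α β / 2 : ℝ) : ℂ))))).mul hC'
  have hy' : fderiv ℝ (expLin α β s f) y = _ := HasFDerivAt.fderiv hy
  refine hs.congr_deriv ?_
  rw [linOp, hy']
  simp only [expLin, add_apply, smul_apply, Pi.mul_apply, Pi.neg_apply,
    ContinuousLinearMap.comp_apply, map_neg, smul_eq_mul, Complex.ofRealCLM_apply,
    innerSL_apply_apply, real_inner_comm α β]
  push_cast
  linear_combination (-(Complex.exp (-(Complex.I * ((s:ℂ) ^ 2 * ((inner ℝ α β : ℝ) : ℂ) / 2))) *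
    Complex.exp (Complex.I * ((s:ℂ) * ((inner ℝ β y : ℝ) : ℂ))) *
    (fderiv ℝ f (y - s • α) α + Complex.I * s * ((inner ℝ α β : ℝ) : ℂ) * f (y - s • α)))) *
    Complex.I_sq

/-! ### The transfer operator -/

/-- The truncated integral `∫_{-R}^{R} e^{i μ s²} e^{i s (β·y - α·D_y)} φ ds` at the point `y`. -/
def transferTrunc {d : ℕ} (μ : ℝ) (α β : E d) (R : ℝ) (φ : E d → ℂ) (y : E d) : ℂ :=
  ∫ s in (-R)..R, Complex.exp (Complex.I * ((μ * s ^ 2 : ℝ) : ℂ)) * expLin α β s φ y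

/-- `𝒯_{μ,α,β} φ = ψ`: the integrals over `[-R, R]` tend to `ψ`, in the sense of
tempered distributions, as `R → ∞`. -/
def IsTransfer {d : ℕ} (μ : ℝ) (α β : E d) (φ ψ : 𝓢(E d, ℂ)) : Prop :=
  ∀ χ : 𝓢(E d, ℂ),
    Tendsto (fun R : ℝ => ∫ y, transferTrunc μ α β R φ y * χ y) atTop (𝓝 (∫ y, ψ y * χ y))

/-- The limit defining `𝒯_{μ,α,β} φ` is a Schwartz function for every Schwartz function `φ`. -/
def MapsSchwartz {d : ℕ} (μ : ℝ) (α β : E d) : Prop :=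
  ∀ φ : 𝓢(E d, ℂ), ∃ ψ : 𝓢(E d, ℂ), IsTransfer μ α β φ ψ

/-! ### Unitary groups, Weyl quantization, metaplectic transformations -/

/-- `U(t) = e^{-itH}`: a strongly continuous one-parameter unitary group on `L²` whose
derivative at `0` on Schwartz functions is `-iH`. -/
structure IsUnitaryGroup {d : ℕ} (H : (E d → ℂ) → (E d → ℂ)) (U : ℝ → (L2 d ≃ₗᵢ[ℂ] L2 d)) :
    Prop where
  map_zero : ∀ f, U 0 f = f
  map_add : ∀ s t f, U (s + t) f = U s (U t f)
  continuous : ∀ f, Continuous fun t => U t f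
  generator : ∀ φ : 𝓢(E d, ℂ), ∃ g : L2 d, (g : E d → ℂ) =ᵐ[volume] H φ ∧
    HasDerivAt (fun t => U t (toL2 φ)) (-Complex.I • g) 0

/-- Weyl quantization `op^w_1(a)`, as an iterated integral (first in `y`, then in `ξ`). -/
def weylOp {d : ℕ} (a : (PhIdx d → ℝ) → ℂ) (f : E d → ℂ) (x : E d) : ℂ :=
  (((2 * Real.pi) ^ d)⁻¹ : ℝ) * ∫ ξ : E d, ∫ y : E d,
    a (Sum.elim (fun i => (x i + y i) / 2) (fun i => ξ i)) *
      Complex.exp (Complex.I * ((inner ℝ ξ (x - y) : ℝ) : ℂ)) * f y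

/-- The quadratic symbol `z ↦ ½ Sz·z`. -/
def quadSymbol {d : ℕ} (S : Matrix (PhIdx d) (PhIdx d) ℝ) (z : PhIdx d → ℝ) : ℂ :=
  ((dotProduct (S.mulVec z) z / 2 : ℝ) : ℂ)

/-- The matrix `J = [[0, 1], [-1, 0]]`, so that Hamilton's equations read `ż = J ∇h(z)`. -/
def symplJ (d : ℕ) : Matrix (PhIdx d) (PhIdx d) ℝ := Matrix.fromBlocks 0 1 (-1) 0

/-- `M` is a metaplectic transformation associated with the matrix `F`: there are a smooth family
of quadratic Hamiltonians `½ S(t)z·z` and times `t₀, t₁` such that `F = G(t₁)` for the linear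
Hamiltonian flow `G' = J S G`, `G(t₀) = 1`, and `M` is the unitary propagator from `t₀` to `t₁` of
`i ∂_t u = op^w_1(½ S(t)z·z) u`. -/
def IsMetaplectic {d : ℕ} (M : L2 d ≃ₗᵢ[ℂ] L2 d) (F : Matrix (PhIdx d) (PhIdx d) ℝ) : Prop :=
  ∃ (S G : ℝ → Matrix (PhIdx d) (PhIdx d) ℝ) (U : ℝ → (L2 d ≃ₗᵢ[ℂ] L2 d)) (t₀ t₁ : ℝ),
    (∀ t, (S t).IsSymm) ∧
    (∀ i j, ContDiff ℝ ∞ fun t => S t i j) ∧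
    G t₀ = 1 ∧
    (∀ t i j, HasDerivAt (fun r => G r i j) ((symplJ d * S t * G t) i j) t) ∧
    (∀ φ : 𝓢(E d, ℂ), ∃ u : ℝ → 𝓢(E d, ℂ), u t₀ = φ ∧
      ∀ t, U t (toL2 φ) = toL2 (u t) ∧
        ∃ g : L2 d, (g : E d → ℂ) =ᵐ[volume] weylOp (quadSymbol (S t)) (u t) ∧
          HasDerivAt (fun r => toL2 (u r)) (-Complex.I • g) t) ∧
    F = G t₁ ∧ M = U t₁

/-- The linear flow `Φ_{α,β}(t)` of the Hamiltonian `(β·y - α·η)²`, in block form. -/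
def flowPhi {d : ℕ} (α β : E d) (t : ℝ) : Matrix (PhIdx d) (PhIdx d) ℝ :=
  Matrix.fromBlocks
    (1 - (2 * t) • Matrix.vecMulVec (fun i => α i) (fun i => β i))
    ((2 * t) • Matrix.vecMulVec (fun i => α i) (fun i => α i))
    (-(2 * t) • Matrix.vecMulVec (fun i => β i) (fun i => β i))
    (1 + (2 * t) • Matrix.vecMulVec (fun i => β i) (fun i => α i))

/-! ### Gaussians and polynomial symbols -/

/-- The Siegel half-space `𝔖⁺(d)`: complex symmetric matrices with positive imaginary part. -/
def Siegel {d : ℕ} (Γ : Matrix (Fin d) (Fin d) ℂ) : Prop :=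
  Γ.IsSymm ∧ (Γ.map Complex.im).PosDef

/-- A real vector seen as a complex vector. -/
def toC {d : ℕ} (x : E d) : Fin d → ℂ := fun i => ((x i : ℝ) : ℂ)

/-- The Gaussian `c exp((i/2) Γx·x)`. -/
def gaussian {d : ℕ} (c : ℂ) (Γ : Matrix (Fin d) (Fin d) ℂ) (x : E d) : ℂ :=
  c * Complex.exp (Complex.I / 2 * dotProduct (Γ.mulVec (toC x)) (toC x))

/-- `c` is an `L²`-normalization constant of the Gaussian of width `Γ`:
its modulus is `π^{-d/4} det(Im Γ)^{1/4}`, its argument is free. -/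
def IsNormConst {d : ℕ} (c : ℂ) (Γ : Matrix (Fin d) (Fin d) ℂ) : Prop :=
  ‖c‖ = Real.pi ^ (-(d : ℝ) / 4) * (Γ.map Complex.im).det ^ (1 / 4 : ℝ)

/-- The polynomial function on phase space given by `p`. -/
def polySymbol {d : ℕ} (p : MvPolynomial (PhIdx d) ℂ) (z : PhIdx d → ℝ) : ℂ :=
  MvPolynomial.eval (fun i => ((z i : ℝ) : ℂ)) p

/-- The complex number `2μ - α·β + α·Γα`. -/
def widthDenom {d : ℕ} (μ : ℝ) (α β : E d) (Γ : Matrix (Fin d) (Fin d) ℂ) : ℂ :=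
  2 * (μ : ℂ) - dotProduct (toC α) (toC β) + dotProduct (toC α) (Γ.mulVec (toC α))

/-- `Γ_{μ,α,β,Γ} = Γ - (β - Γα) ⊗ (β - Γα) / (2μ - α·β + α·Γα)`. -/
def newWidth {d : ℕ} (μ : ℝ) (α β : E d) (Γ : Matrix (Fin d) (Fin d) ℂ) :
    Matrix (Fin d) (Fin d) ℂ :=
  Γ - (widthDenom μ α β Γ)⁻¹ •
    Matrix.vecMulVec (toC β - Γ.mulVec (toC α)) (toC β - Γ.mulVec (toC α))

/-- `√(iπ/μ)`, principal branch. -/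
def fresnelConst (μ : ℝ) : ℂ := (Complex.I * Real.pi / μ) ^ (1 / 2 : ℂ)

end TransferOp

end

/-! The operator `L = β·y - α·D_y` can be diagonalized inside the Schwartz space. If `α = 0` it is
already multiplication by `β·y`. If `α ≠ 0`, conjugation by `exp(i q)`, with `q` a quadratic form
whose derivative along `α` is `β·y`, leaves `-α·D_y`, and the Fourier transform makes this
multiplication by `β'·ξ` with `β' = -2πα` (`exists_diagonalizes`). Then `exp(isL)` is multiplication
by `exp(is β'·ξ)`, and completing the square in `∫ exp(iμs² + isx) ds` gives `√(iπ/μ)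
exp(-ix²/(4μ))` at `x = β'·ξ`, which is the symbol of `√(iπ/μ) exp(-iL²/(4μ))`. The truncated
integrals are bounded uniformly in `R` and `x`, so dominated convergence gives both the weak and the
pointwise limit.

For `μ = 0` the truncations are `2 sin(Rx)/x`. By Riemann-Lebesgue a Schwartz limit is annihilated
by `β'·ξ`, hence zero when `β' ≠ 0`; but testing against a Gaussian gives positive increasing
integrals. If `β' = 0` these grow like `2R`.

The group `exp(-itL²)` is multiplication by `exp(-it(β'·ξ)²)` in the diagonal picture, extended to
`L²` by density. It preserves the Schwartz space, so any other group with the same generator there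
agrees with it (`eq_unitary`). Since `[L, a·y + b·D]` is a scalar, it conjugates linear symbols by
the linear flow (`propagator_lin`).

For polynomial symbols, Weyl quantization turns multiplication by a coordinate into the symmetrized
product with its operator (`isWeyl_jordan_coordOp`). Linear covariance on coordinates therefore
propagates to all polynomials (`IsWeyl.map_apply`), and only the Gaussian itself remains to be
computed. Its transform is a Gaussian integral in `s`; the new width is the image of `Γ` under the
fractional linear action of the flow, so positivity and normalization follow from the identity `N*
(Im Γ') N = Im Γ` with `det N = (2μ - α·β + α·Γα)/(2μ)` (`conj_im_newWidth`, `det_intertwiner`). -/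

noncomputable section

namespace TransferOp

/-! ### Exponentials of functions of temperate growth -/

/-- The real derivative of `exp` is `exp` followed by the multiplication map, which has norm at most
one; each differentiation therefore costs nothing. -/
theorem norm_iteratedFDeriv_cexp_le (n : ℕ) (z : ℂ) :
    ‖iteratedFDeriv ℝ n Complex.exp z‖ ≤ Real.exp z.re := by
  induction n with
  | zero => simp [Complex.norm_exp]
  | succ n ih =>
    have h : fderiv ℝ Complex.exp = ContinuousLinearMap.mul ℝ ℂ ∘ Complex.exp := by
      funext w
      ext v
      simpa [mul_comm] using congrArg (fun L : ℂ →L[ℝ] ℂ => L v)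
        ((Complex.hasDerivAt_exp w).hasFDerivAt.restrictScalars ℝ).fderiv
    rw [← norm_iteratedFDeriv_fderiv, h]
    refine (ContinuousLinearMap.norm_iteratedFDeriv_comp_left (N := ∞) _
      (Complex.contDiff_exp (𝕜 := ℝ)).contDiffAt (mod_cast le_top)).trans ?_
    calc _ ≤ 1 * Real.exp z.re :=
          mul_le_mul (ContinuousLinearMap.opNorm_mul_le ℝ ℂ) ih (norm_nonneg _) zero_le_one
      _ = _ := one_mul _

theorem exists_norm_iteratedFDeriv_cexp_comp_le {F : Type*} [NormedAddCommGroup F]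
    [NormedSpace ℝ F] {f : F → ℂ} (hf : f.HasTemperateGrowth) (n : ℕ) :
    ∃ (k : ℕ) (C : ℝ), 0 ≤ C ∧ ∀ x,
      ‖iteratedFDeriv ℝ n (fun x => Complex.exp (f x)) x‖ ≤
        C * (1 + ‖x‖) ^ k * Real.exp (f x).re := by
  obtain ⟨k, C, hC, h⟩ := hf.norm_iteratedFDeriv_le_uniform n
  refine ⟨k * n, n.factorial * (C + 1) ^ n, by positivity, fun x => ?_⟩
  have hx : 1 ≤ (1 + ‖x‖) ^ k := one_le_pow₀ (by linarith [norm_nonneg x])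
  -- The Faà di Bruno bound asks for `‖D^i f‖ ≤ D^i` for `1 ≤ i ≤ n`. Taking `C + 1` instead of `C`
  -- makes the base at least one, so a bound by its first power suffices.
  have := norm_iteratedFDeriv_comp_le (n := n) (N := ∞) (g := Complex.exp) (f := f)
    Complex.contDiff_exp hf.1 (mod_cast le_top) x (C := Real.exp (f x).re)
    (D := (C + 1) * (1 + ‖x‖) ^ k) (fun i _ => norm_iteratedFDeriv_cexp_le i _)
    (fun i hi hin => by
      calc _ ≤ C * (1 + ‖x‖) ^ k := h i hin x
        _ ≤ (C + 1) * (1 + ‖x‖) ^ k := by gcongr; linarith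
        _ ≤ _ := le_self_pow₀ (one_le_mul_of_one_le_of_one_le (by linarith) hx) (by omega))
  refine this.trans (le_of_eq ?_)
  rw [mul_pow, ← pow_mul]
  ring

theorem hasTemperateGrowth_cexp {F : Type*} [NormedAddCommGroup F] [NormedSpace ℝ F]
    {f : F → ℂ} (hf : f.HasTemperateGrowth) (h : ∀ x, (f x).re ≤ 0) :
    (fun x => Complex.exp (f x)).HasTemperateGrowth := by
  refine ⟨Complex.contDiff_exp.comp hf.1, fun n => ?_⟩
  obtain ⟨k, C, hC, hb⟩ := exists_norm_iteratedFDeriv_cexp_comp_le hf n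
  exact ⟨k, C, fun x => (hb x).trans
    (mul_le_of_le_one_right (by positivity) (Real.exp_le_one_iff.2 (h x)))⟩

theorem hasTemperateGrowth_cexp_I_mul {F : Type*} [NormedAddCommGroup F] [NormedSpace ℝ F]
    {g : F → ℝ} (hg : g.HasTemperateGrowth) :
    (fun x => Complex.exp (Complex.I * (g x : ℂ))).HasTemperateGrowth := by
  refine hasTemperateGrowth_cexp (f := fun x => Complex.I * (g x : ℂ)) ?_ (by simp)
  have h := Function.Complex.hasTemperateGrowth_ofReal.comp hg
  exact (Function.HasTemperateGrowth.const Complex.I).mul h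

/-- The exponential of a function of temperate growth whose real part is at most `-c‖x‖²`. -/
def expSchwartz {d : ℕ} (f : E d → ℂ) (hf : f.HasTemperateGrowth) (c : ℝ) (hc : 0 < c)
    (h : ∀ x, (f x).re ≤ -c * ‖x‖ ^ 2) : 𝓢(E d, ℂ) where
  toFun x := Complex.exp (f x)
  smooth' := Complex.contDiff_exp.comp hf.1
  decay' m n := by
    obtain ⟨k, C, hC, hb⟩ := exists_norm_iteratedFDeriv_cexp_comp_le hf n
    -- The exponent `(m + k)²/(4c)` is the maximum over `r` of `(m + k) r - c r²`.
    refine ⟨C * Real.exp ((m + k : ℕ) ^ 2 / (4 * c)), fun x => ?_⟩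
    have h1 : ‖x‖ ^ m ≤ (1 + ‖x‖) ^ m := by gcongr; linarith
    have h2 : (1 + ‖x‖) ^ (m + k) ≤ Real.exp ((m + k : ℕ) * ‖x‖) := by
      rw [Real.exp_nat_mul]
      gcongr
      linarith [Real.add_one_le_exp ‖x‖]
    calc _ ≤ (1 + ‖x‖) ^ m * (C * (1 + ‖x‖) ^ k * Real.exp (-c * ‖x‖ ^ 2)) := by
          refine mul_le_mul h1 ((hb x).trans ?_) (norm_nonneg _) (by positivity)
          gcongr
          exact h x
      _ = C * ((1 + ‖x‖) ^ (m + k) * Real.exp (-c * ‖x‖ ^ 2)) := by ring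
      _ ≤ C * (Real.exp ((m + k : ℕ) * ‖x‖) * Real.exp (-c * ‖x‖ ^ 2)) := by gcongr
      _ ≤ _ := by
          rw [← Real.exp_add]
          gcongr
          rw [le_div_iff₀ (by positivity)]
          nlinarith [sq_nonneg ((m + k : ℕ) - 2 * c * ‖x‖)]

@[simp] theorem expSchwartz_apply {d : ℕ} (f : E d → ℂ) (hf : f.HasTemperateGrowth) (c : ℝ)
    (hc : 0 < c) (h : ∀ x, (f x).re ≤ -c * ‖x‖ ^ 2) (x : E d) :
    expSchwartz f hf c hc h x = Complex.exp (f x) := rfl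

/-! ### Multiplication by phases -/

/-- Multiplication by `exp(i g)` on the Schwartz space. -/
def phaseMul {d : ℕ} (g : E d → ℝ) (hg : g.HasTemperateGrowth) : 𝓢(E d, ℂ) ≃ₗ[ℂ] 𝓢(E d, ℂ) where
  toFun φ := SchwartzMap.smulLeftCLM ℂ (fun y => Complex.exp (Complex.I * (g y : ℂ))) φ
  map_add' := map_add _
  map_smul' := map_smul _
  invFun φ := SchwartzMap.smulLeftCLM ℂ (fun y => Complex.exp (Complex.I * ((-g y : ℝ) : ℂ))) φ
  left_inv φ := by
    ext y
    rw [SchwartzMap.smulLeftCLM_apply_apply (hasTemperateGrowth_cexp_I_mul hg.fun_neg),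
      SchwartzMap.smulLeftCLM_apply_apply (hasTemperateGrowth_cexp_I_mul hg), smul_smul,
      ← Complex.exp_add]
    simp
  right_inv φ := by
    ext y
    rw [SchwartzMap.smulLeftCLM_apply_apply (hasTemperateGrowth_cexp_I_mul hg),
      SchwartzMap.smulLeftCLM_apply_apply (hasTemperateGrowth_cexp_I_mul hg.fun_neg), smul_smul,
      ← Complex.exp_add]
    simp

theorem phaseMul_apply {d : ℕ} (g : E d → ℝ) (hg : g.HasTemperateGrowth) (φ : 𝓢(E d, ℂ))
    (y : E d) : phaseMul g hg φ y = Complex.exp (Complex.I * (g y : ℂ)) * φ y :=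
  SchwartzMap.smulLeftCLM_apply_apply (hasTemperateGrowth_cexp_I_mul hg) φ y

theorem norm_phaseMul_apply {d : ℕ} (g : E d → ℝ) (hg : g.HasTemperateGrowth) (φ : 𝓢(E d, ℂ))
    (y : E d) : ‖phaseMul g hg φ y‖ = ‖φ y‖ := by
  rw [phaseMul_apply, norm_mul, mul_comm Complex.I, Complex.norm_exp_ofReal_mul_I, one_mul]

theorem norm_toL2_le {d : ℕ} {φ ψ : 𝓢(E d, ℂ)} {C : ℝ} (h : ∀ y, ‖φ y‖ ≤ C * ‖ψ y‖) :
    ‖toL2 φ‖ ≤ C * ‖toL2 ψ‖ := by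
  refine Lp.norm_le_mul_norm_of_ae_le_mul ?_
  filter_upwards [φ.coeFn_toLp 2 volume, ψ.coeFn_toLp 2 volume] with y h1 h2
  simp only [toL2, h1, h2]
  exact h y

theorem norm_toL2_congr {d : ℕ} {φ ψ : 𝓢(E d, ℂ)} (h : ∀ y, ‖φ y‖ = ‖ψ y‖) :
    ‖toL2 φ‖ = ‖toL2 ψ‖ :=
  le_antisymm (by simpa using norm_toL2_le (C := 1) fun y => by simp [h y])
    (by simpa using norm_toL2_le (C := 1) fun y => by simp [h y])

theorem norm_toL2_phaseMul {d : ℕ} (g : E d → ℝ) (hg : g.HasTemperateGrowth) (φ : 𝓢(E d, ℂ)) :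
    ‖toL2 (phaseMul g hg φ)‖ = ‖toL2 φ‖ :=
  norm_toL2_congr (norm_phaseMul_apply g hg φ)

/-! ### First order operators with linear symbols -/

/-- The operator `a·y + b·D_y` on the Schwartz space, where `D_y = -i ∂_y`. -/
def lin {d : ℕ} (a b : E d) : 𝓢(E d, ℂ) →ₗ[ℂ] 𝓢(E d, ℂ) :=
  (SchwartzMap.smulLeftCLM ℂ (fun y : E d => ((inner ℝ a y : ℝ) : ℂ))).toLinearMap -
    Complex.I • (LineDeriv.lineDerivOpCLM ℂ 𝓢(E d, ℂ) b).toLinearMap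

theorem hasTemperateGrowth_inner_ofReal {d : ℕ} (a : E d) :
    (fun y : E d => ((inner ℝ a y : ℝ) : ℂ)).HasTemperateGrowth := by
  fun_prop

theorem lin_apply {d : ℕ} (a b : E d) (φ : 𝓢(E d, ℂ)) (y : E d) :
    lin a b φ y = ((inner ℝ a y : ℝ) : ℂ) * φ y - Complex.I * fderiv ℝ φ y b := by
  simp [lin, SchwartzMap.smulLeftCLM_apply_apply (hasTemperateGrowth_inner_ofReal a),
    SchwartzMap.lineDerivOp_apply_eq_fderiv]

theorem linOp_eq_lin {d : ℕ} (α β : E d) (φ : 𝓢(E d, ℂ)) : linOp α β φ = lin β (-α) φ := by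
  funext y
  simp [linOp, lin_apply]

theorem lin_add {d : ℕ} (a b a' b' : E d) : lin (a + a') (b + b') = lin a b + lin a' b' := by
  ext φ y
  simp [lin_apply, inner_add_left]
  ring

theorem lin_smul {d : ℕ} (r : ℝ) (a b : E d) : lin (r • a) (r • b) = (r : ℂ) • lin a b := by
  ext φ y
  simp [lin_apply, inner_smul_left]
  ring

/-- Conjugation of a first order operator by the phase `exp(i g)`. -/
theorem lin_phaseMul {d : ℕ} (g : E d → ℝ) (hg : g.HasTemperateGrowth) (a b h : E d)
    (hd : ∀ y, HasLineDerivAt ℝ g (inner ℝ h y) y b) (φ : 𝓢(E d, ℂ)) :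
    lin a b (phaseMul g hg φ) = phaseMul g hg (lin (a + h) b φ) := by
  ext y
  have hgd : Differentiable ℝ g := hg.1.differentiable (by simp)
  have h1 : HasFDerivAt (fun y => ((g y : ℝ) : ℂ)) (Complex.ofRealCLM.comp (fderiv ℝ g y)) y :=
    Complex.ofRealCLM.hasFDerivAt.comp y (hgd y).hasFDerivAt
  have h2 : HasFDerivAt (phaseMul g hg φ) _ y :=
    ((h1.const_mul Complex.I).cexp.mul φ.differentiableAt.hasFDerivAt).congr_of_eventuallyEq
      (.of_forall fun y => phaseMul_apply g hg φ y)
  have h3 : fderiv ℝ g y b = inner ℝ h y := by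
    rw [← (hgd y).lineDeriv_eq_fderiv]
    exact (hd y).lineDeriv
  rw [lin_apply, phaseMul_apply, phaseMul_apply, lin_apply, h2.fderiv]
  simp [h3, inner_add_left]
  linear_combination (-(Complex.exp (Complex.I * (g y : ℂ)) * ((inner ℝ h y : ℝ) : ℂ) * φ y)) *
    Complex.I_sq

/-- Conjugation of a first order operator by the inverse Fourier transform. -/
theorem lin_fourierInv {d : ℕ} (a b : E d) (φ : 𝓢(E d, ℂ)) :
    lin a b (FourierTransform.fourierInv φ) = FourierTransform.fourierInv
      (lin ((2 * Real.pi) • b) (-(2 * Real.pi)⁻¹ • a) φ) := by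
  have hpi : (Real.pi : ℂ) ≠ 0 := by exact_mod_cast Real.pi_ne_zero
  have h1 : lin ((2 * Real.pi) • b) (-(2 * Real.pi)⁻¹ • a) φ =
      (-Complex.I) • ((2 * Real.pi * Complex.I) •
        SchwartzMap.smulLeftCLM ℂ (fun x : E d => inner ℝ x b) φ) +
      (Complex.I * (2 * Real.pi)⁻¹ : ℂ) • LineDeriv.lineDerivOp a φ := by
    ext y
    have hb : (fun x : E d => inner ℝ x b).HasTemperateGrowth := by fun_prop
    simp [lin_apply, SchwartzMap.lineDerivOp_apply_eq_fderiv, inner_smul_left,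
      SchwartzMap.smulLeftCLM_apply_apply hb, real_inner_comm b y]
    linear_combination (2 * (Real.pi : ℂ) * ((inner ℝ b y : ℝ) : ℂ) * φ y) * Complex.I_sq
  rw [h1, FourierTransform.fourierInv_add, FourierTransform.fourierInv_smul,
    ← SchwartzMap.lineDerivOp_fourierInv_eq, FourierTransform.fourierInv_smul,
    SchwartzMap.fourierInv_lineDerivOp_eq]
  ext y
  have ha : (fun x : E d => inner ℝ x a).HasTemperateGrowth := by fun_prop
  simp [lin_apply, SchwartzMap.lineDerivOp_apply_eq_fderiv,
    SchwartzMap.smulLeftCLM_apply_apply ha, real_inner_comm a y]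
  field_simp
  linear_combination (((inner ℝ a y : ℝ) : ℂ) *
    (FourierTransform.fourierInv φ : 𝓢(E d, ℂ)) y) * Complex.I_sq

/-! ### Fresnel integrals -/

theorem norm_cexp_neg_mul_sq_le_one {b : ℂ} (hb : 0 ≤ b.re) (s : ℝ) :
    ‖Complex.exp (-b * (s : ℂ) ^ 2)‖ ≤ 1 := by
  rw [Complex.norm_exp, Real.exp_le_one_iff, ← Complex.ofReal_pow, Complex.re_mul_ofReal,
    Complex.neg_re]
  nlinarith [mul_nonneg hb (sq_nonneg s)]

/-- Integration by parts with `-exp(-bs²)/(2bs)`: the boundary terms and the remaining integral of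
`s⁻²` add up to exactly `1/(‖b‖R)`. The estimate only uses `Re b ≥ 0`, so it survives on the
imaginary axis, where the integral is not absolutely convergent. -/
theorem norm_integral_cexp_neg_mul_sq_le {b : ℂ} (hb : 0 ≤ b.re) (hb0 : b ≠ 0) {R R' : ℝ}
    (hR : 0 < R) (hRR' : R ≤ R') :
    ‖∫ s in R..R', Complex.exp (-b * (s : ℂ) ^ 2)‖ ≤ 1 / (‖b‖ * R) := by
  have hpos : ∀ s ∈ Set.uIcc R R', 0 < s := fun s hs => by
    rw [Set.uIcc_of_le hRR'] at hs
    exact hR.trans_le hs.1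
  have hb' : 0 < ‖b‖ := norm_pos_iff.2 hb0
  have hder : ∀ s ∈ Set.uIcc R R', HasDerivAt
      (fun s : ℝ => -(Complex.exp (-b * (s : ℂ) ^ 2) / (2 * b * s)))
      (Complex.exp (-b * (s : ℂ) ^ 2) + Complex.exp (-b * (s : ℂ) ^ 2) / (2 * b * s ^ 2)) s := by
    intro s hs
    have hs0 : (s : ℂ) ≠ 0 := by exact_mod_cast (hpos s hs).ne'
    have h1 : HasDerivAt (fun s : ℝ => (s : ℂ)) 1 s := Complex.ofRealCLM.hasDerivAt
    have h2 := (((h1.pow 2).const_mul (-b)).cexp.div (h1.const_mul (2 * b))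
      (by simp [hb0, hs0])).neg
    refine h2.congr_deriv ?_
    simp
    field_simp
    ring
  have hc1 : ContinuousOn (fun s : ℝ => Complex.exp (-b * (s : ℂ) ^ 2)) (Set.uIcc R R') := by
    fun_prop
  have hc2 : ContinuousOn (fun s : ℝ => Complex.exp (-b * (s : ℂ) ^ 2) / (2 * b * s ^ 2))
      (Set.uIcc R R') := by
    refine hc1.div (by fun_prop) fun s hs => ?_
    have hs0 : (s : ℂ) ≠ 0 := by exact_mod_cast (hpos s hs).ne'
    simp [hb0, hs0]
  have hint := intervalIntegral.integral_eq_sub_of_hasDerivAt hder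
    (hc1.add hc2).intervalIntegrable
  rw [intervalIntegral.integral_add hc1.intervalIntegrable hc2.intervalIntegrable] at hint
  have hbd : ∀ s ∈ Set.uIcc R R', ‖Complex.exp (-b * (s : ℂ) ^ 2) / (2 * b * s)‖ ≤
      1 / (2 * ‖b‖) * s⁻¹ := fun s hs => by
    have hs0 := hpos s hs
    rw [norm_div, norm_mul, norm_mul, Complex.norm_real, Real.norm_of_nonneg hs0.le,
      Complex.norm_ofNat]
    calc _ ≤ 1 / (2 * ‖b‖ * s) := by
          gcongr
          exact norm_cexp_neg_mul_sq_le_one hb s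
      _ = _ := by field_simp
  have hI : ‖∫ s in R..R', Complex.exp (-b * (s : ℂ) ^ 2) / (2 * b * s ^ 2)‖ ≤
      1 / (2 * ‖b‖) * (R⁻¹ - R'⁻¹) := by
    have hd : ∀ s ∈ Set.uIcc R R', HasDerivAt (fun s : ℝ => -(1 / (2 * ‖b‖) * s⁻¹))
        (1 / (2 * ‖b‖) * (s ^ 2)⁻¹) s := fun s hs => by
      refine ((hasDerivAt_inv (hpos s hs).ne').const_mul _).neg.congr_deriv ?_
      ring
    have hc : ContinuousOn (fun s : ℝ => 1 / (2 * ‖b‖) * (s ^ 2)⁻¹) (Set.uIcc R R') := by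
      refine continuousOn_const.mul (ContinuousOn.inv₀ (by fun_prop) fun s hs => ?_)
      exact pow_ne_zero _ (hpos s hs).ne'
    have he := intervalIntegral.integral_eq_sub_of_hasDerivAt hd hc.intervalIntegrable
    refine (intervalIntegral.norm_integral_le_of_norm_le hRR' (.of_forall fun s hs => ?_)
      hc.intervalIntegrable).trans (le_of_eq ?_)
    · have hs0 : 0 < s := hR.trans hs.1
      rw [norm_div, norm_mul, norm_mul, norm_pow, Complex.norm_real, Real.norm_of_nonneg hs0.le,
        Complex.norm_ofNat]
      calc _ ≤ 1 / (2 * ‖b‖ * s ^ 2) := by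
            gcongr
            exact norm_cexp_neg_mul_sq_le_one hb s
        _ = _ := by field_simp
    · rw [he]
      ring
  have h1 := hbd R Set.left_mem_uIcc
  have h2 := hbd R' Set.right_mem_uIcc
  have hE : ∫ s in R..R', Complex.exp (-b * (s : ℂ) ^ 2) =
      Complex.exp (-b * (R : ℂ) ^ 2) / (2 * b * R) -
        Complex.exp (-b * (R' : ℂ) ^ 2) / (2 * b * R') -
        ∫ s in R..R', Complex.exp (-b * (s : ℂ) ^ 2) / (2 * b * s ^ 2) := by
    linear_combination hint
  calc _ ≤ 1 / (2 * ‖b‖) * R⁻¹ + 1 / (2 * ‖b‖) * R'⁻¹ + 1 / (2 * ‖b‖) * (R⁻¹ - R'⁻¹) := by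
        rw [hE]
        refine (norm_sub_le _ _).trans (add_le_add ((norm_sub_le _ _).trans (add_le_add h1 h2)) hI)
    _ = _ := by field_simp; ring

theorem norm_integral_cexp_sub_le_of_re_pos {b : ℂ} (hb : 0 < b.re) {R : ℝ} (hR : 0 < R) :
    ‖(∫ s in (0 : ℝ)..R, Complex.exp (-b * (s : ℂ) ^ 2)) - (Real.pi / b) ^ (1 / 2 : ℂ) / 2‖ ≤
      1 / (‖b‖ * R) := by
  have hb0 : b ≠ 0 := fun h => by simp [h] at hb
  have hi : ∀ a c : ℝ, IntervalIntegrable (fun s : ℝ => Complex.exp (-b * (s : ℂ) ^ 2)) volume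
    a c := fun a c => Continuous.intervalIntegrable (by fun_prop) _ _
  have ht : Tendsto (fun R' : ℝ => ∫ s in (0 : ℝ)..R', Complex.exp (-b * (s : ℂ) ^ 2)) atTop
      (𝓝 ((Real.pi / b) ^ (1 / 2 : ℂ) / 2)) := by
    rw [← integral_gaussian_complex_Ioi hb]
    exact intervalIntegral_tendsto_integral_Ioi 0 (integrable_cexp_neg_mul_sq hb).integrableOn
      tendsto_id
  refine le_of_tendsto (tendsto_const_nhds.sub ht).norm ?_
  filter_upwards [eventually_ge_atTop R] with R' hR'
  rw [← norm_neg, neg_sub, intervalIntegral.integral_interval_sub_left (hi _ _) (hi _ _)]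
  exact norm_integral_cexp_neg_mul_sq_le hb.le hb0 hR hR'

theorem pi_div_mem_slitPlane {b : ℂ} (hb : 0 ≤ b.re) (hb0 : b ≠ 0) :
    (Real.pi : ℂ) / b ∈ Complex.slitPlane := by
  rw [div_eq_mul_inv, mul_comm, Complex.mem_slitPlane_iff, Complex.re_mul_ofReal,
    Complex.im_mul_ofReal, Complex.inv_re, Complex.inv_im]
  have hn : 0 < Complex.normSq b := Complex.normSq_pos.2 hb0
  rcases hb.lt_or_eq with h | h
  · left
    have := Real.pi_pos
    positivity
  · right
    have : b.im ≠ 0 := fun h' => hb0 (Complex.ext h.symm h')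
    simp [this, hb0, Real.pi_ne_zero]

/-- The bound for `Re b > 0` is uniform, so it passes to the limit along `b + ε` as `ε → 0⁺`. The
principal root is continuous there because `π/b` stays off the negative axis. -/
theorem norm_integral_cexp_sub_le {b : ℂ} (hb : 0 ≤ b.re) (hb0 : b ≠ 0) {R : ℝ} (hR : 0 < R) :
    ‖(∫ s in (0 : ℝ)..R, Complex.exp (-b * (s : ℂ) ^ 2)) - (Real.pi / b) ^ (1 / 2 : ℂ) / 2‖ ≤
      1 / (‖b‖ * R) := by
  have hc : Tendsto (fun ε : ℝ => b + ε) (𝓝[>] 0) (𝓝 b) := by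
    have : Continuous fun ε : ℝ => b + ε := by fun_prop
    simpa using (this.tendsto 0).mono_left nhdsWithin_le_nhds
  have h1 : Continuous fun c : ℂ => ∫ s in (0 : ℝ)..R, Complex.exp (-c * (s : ℂ) ^ 2) :=
    intervalIntegral.continuous_parametric_intervalIntegral_of_continuous' (by fun_prop) 0 R
  have h2 : ContinuousAt (fun c : ℂ => (Real.pi / c) ^ (1 / 2 : ℂ) / 2) b :=
    ((continuousAt_const.div continuousAt_id hb0).cpow continuousAt_const
      (pi_div_mem_slitPlane hb hb0)).div_const 2
  have h3 : ContinuousAt (fun c : ℂ => 1 / (‖c‖ * R)) b :=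
    continuousAt_const.div (by fun_prop) (by positivity)
  refine le_of_tendsto_of_tendsto (((h1.tendsto b).comp hc).sub (h2.tendsto.comp hc)).norm
    (h3.tendsto.comp hc) ?_
  filter_upwards [self_mem_nhdsWithin] with ε hε
  have hε' : (0 : ℝ) < ε := hε
  exact norm_integral_cexp_sub_le_of_re_pos (b := b + ε) (by simp; linarith) hR

theorem tendsto_integral_cexp_neg_mul_sq {b : ℂ} (hb : 0 ≤ b.re) (hb0 : b ≠ 0) :
    Tendsto (fun R : ℝ => ∫ s in (0 : ℝ)..R, Complex.exp (-b * (s : ℂ) ^ 2)) atTop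
      (𝓝 ((Real.pi / b) ^ (1 / 2 : ℂ) / 2)) := by
  rw [tendsto_iff_norm_sub_tendsto_zero]
  refine squeeze_zero' (.of_forall fun _ => norm_nonneg _)
    ((eventually_gt_atTop 0).mono fun R hR => norm_integral_cexp_sub_le hb hb0 hR) ?_
  have : 0 < ‖b‖ := norm_pos_iff.2 hb0
  simpa [mul_comm, Pi.inv_def] using (tendsto_id.const_mul_atTop this).inv_tendsto_atTop

/-- The Fresnel integral `∫_0^r exp(i μ s²) ds`. -/
def fresnel (μ r : ℝ) : ℂ := ∫ s in (0 : ℝ)..r, Complex.exp (Complex.I * ((μ * s ^ 2 : ℝ) : ℂ))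

theorem fresnel_neg (μ r : ℝ) : fresnel μ (-r) = -fresnel μ r := by
  have := intervalIntegral.integral_comp_neg (a := 0) (b := r)
    (fun s : ℝ => Complex.exp (Complex.I * ((μ * s ^ 2 : ℝ) : ℂ)))
  simp only [neg_zero, neg_sq] at this
  rw [fresnel, fresnel, this, intervalIntegral.integral_symm]

theorem fresnel_eq (μ r : ℝ) :
    fresnel μ r = ∫ s in (0 : ℝ)..r, Complex.exp (-(-(Complex.I * μ)) * (s : ℂ) ^ 2) := by
  simp [fresnel, mul_assoc]

theorem fresnelConst_eq (μ : ℝ) :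
    fresnelConst μ = (Real.pi / (-(Complex.I * μ))) ^ (1 / 2 : ℂ) := by
  rw [fresnelConst]
  congr 1
  rw [neg_mul_eq_mul_neg, div_mul_eq_div_div, Complex.div_I]
  rw [div_neg]
  ring

theorem fresnelConst_ne_zero {μ : ℝ} (hμ : μ ≠ 0) : fresnelConst μ ≠ 0 := by
  simp [fresnelConst, Complex.cpow_eq_zero_iff, hμ, Real.pi_ne_zero]

theorem tendsto_fresnel {μ : ℝ} (hμ : μ ≠ 0) :
    Tendsto (fresnel μ) atTop (𝓝 (fresnelConst μ / 2)) := by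
  have := tendsto_integral_cexp_neg_mul_sq (b := -(Complex.I * μ)) (by simp) (by simp [hμ])
  rw [← fresnelConst_eq] at this
  exact this.congr fun r => (fresnel_eq μ r).symm

/-- On `[0, 1]` the integrand has modulus one; beyond `1` the distance to the limit is at most
`1/|μ|`. Oddness covers negative `r`. -/
theorem exists_norm_fresnel_le {μ : ℝ} (hμ : μ ≠ 0) : ∃ C, ∀ r, ‖fresnel μ r‖ ≤ C := by
  have hpos : ∀ r, 0 ≤ r → ‖fresnel μ r‖ ≤ ‖fresnelConst μ / 2‖ + 1 / |μ| + 1 := fun r hr => by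
    rcases le_total r 1 with h1 | h1
    · have : ‖fresnel μ r‖ ≤ 1 * |r - 0| := intervalIntegral.norm_integral_le_of_norm_le_const
        fun s _ => by rw [mul_comm, Complex.norm_exp_ofReal_mul_I]
      rw [sub_zero, abs_of_nonneg hr] at this
      have h2 : 0 ≤ 1 / |μ| := by positivity
      linarith [norm_nonneg (fresnelConst μ / 2)]
    · have h := norm_integral_cexp_sub_le (b := -(Complex.I * μ)) (by simp) (by simp [hμ])
        (zero_lt_one.trans_le h1)
      rw [← fresnelConst_eq, ← fresnel_eq] at h
      have h3 : 1 / (‖-(Complex.I * (μ : ℂ))‖ * r) ≤ 1 / |μ| := by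
        simp only [norm_neg, norm_mul, Complex.norm_I, one_mul, Complex.norm_real,
          Real.norm_eq_abs]
        have : 0 < |μ| := abs_pos.2 hμ
        gcongr
        exact le_mul_of_one_le_right this.le h1
      have := norm_le_insert' (fresnel μ r) (fresnelConst μ / 2)
      linarith
  refine ⟨‖fresnelConst μ / 2‖ + 1 / |μ| + 1, fun r => ?_⟩
  rcases le_total 0 r with h | h
  · exact hpos r h
  · rw [← neg_neg r, fresnel_neg, norm_neg]
    exact hpos _ (neg_nonneg.2 h)

/-- The truncated Fresnel integral `∫_{-R}^R exp(i μ s²) exp(i s x) ds`. -/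
def fresnelTrunc (μ R x : ℝ) : ℂ :=
  ∫ s in (-R)..R, Complex.exp (Complex.I * ((μ * s ^ 2 : ℝ) : ℂ)) *
    Complex.exp (Complex.I * ((s * x : ℝ) : ℂ))

/-- Completing the square shifts the window `[-R, R]` by `x/(2μ)`; oddness of `fresnel` writes the
result as a sum of two values. Both the limit and the bound uniform in `R` and `x` are read off from
this form. -/
theorem fresnelTrunc_eq {μ : ℝ} (hμ : μ ≠ 0) (R x : ℝ) :
    fresnelTrunc μ R x = Complex.exp (Complex.I * ((-(1 / (4 * μ) * x ^ 2) : ℝ) : ℂ)) *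
      (fresnel μ (R + x / (2 * μ)) + fresnel μ (R - x / (2 * μ))) := by
  have hμ' : (μ : ℂ) ≠ 0 := by exact_mod_cast hμ
  have h1 : ∀ s : ℝ, Complex.exp (Complex.I * ((μ * s ^ 2 : ℝ) : ℂ)) *
      Complex.exp (Complex.I * ((s * x : ℝ) : ℂ)) =
      Complex.exp (Complex.I * ((-(1 / (4 * μ) * x ^ 2) : ℝ) : ℂ)) *
        (fun s : ℝ => Complex.exp (Complex.I * ((μ * s ^ 2 : ℝ) : ℂ))) (s + x / (2 * μ)) := by
    intro s
    simp only
    rw [← Complex.exp_add, ← Complex.exp_add, ← mul_add, ← mul_add, ← Complex.ofReal_add,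
      ← Complex.ofReal_add]
    congr 3
    field_simp
    ring
  have hi : ∀ a c : ℝ, IntervalIntegrable
      (fun s : ℝ => Complex.exp (Complex.I * ((μ * s ^ 2 : ℝ) : ℂ))) volume a c :=
    fun a c => Continuous.intervalIntegrable (by fun_prop) _ _
  simp only [fresnelTrunc, h1]
  rw [intervalIntegral.integral_const_mul, intervalIntegral.integral_comp_add_right
    (fun s : ℝ => Complex.exp (Complex.I * ((μ * s ^ 2 : ℝ) : ℂ))),
    ← intervalIntegral.integral_interval_sub_left (hi 0 _) (hi 0 _)]
  have := fresnel_neg μ (R - x / (2 * μ))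
  rw [show -(R - x / (2 * μ)) = -R + x / (2 * μ) by ring] at this
  rw [fresnel, fresnel] at *
  rw [this, sub_neg_eq_add]

theorem tendsto_fresnelTrunc {μ : ℝ} (hμ : μ ≠ 0) (x : ℝ) :
    Tendsto (fun R => fresnelTrunc μ R x) atTop
      (𝓝 (fresnelConst μ * Complex.exp (Complex.I * ((-(1 / (4 * μ) * x ^ 2) : ℝ) : ℂ)))) := by
  have h := (((tendsto_fresnel hμ).comp (tendsto_atTop_add_const_right _ (x / (2 * μ))
    tendsto_id)).add ((tendsto_fresnel hμ).comp (tendsto_atTop_add_const_right _ (-(x / (2 * μ)))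
    tendsto_id))).const_mul (Complex.exp (Complex.I * ((-(1 / (4 * μ) * x ^ 2) : ℝ) : ℂ)))
  rw [add_halves, mul_comm _ (fresnelConst μ)] at h
  refine h.congr fun R => ?_
  rw [fresnelTrunc_eq hμ]
  rfl

theorem exists_norm_fresnelTrunc_le {μ : ℝ} (hμ : μ ≠ 0) :
    ∃ C, ∀ R x, ‖fresnelTrunc μ R x‖ ≤ C := by
  obtain ⟨C, hC⟩ := exists_norm_fresnel_le hμ
  refine ⟨C + C, fun R x => ?_⟩
  rw [fresnelTrunc_eq hμ, norm_mul, mul_comm Complex.I, Complex.norm_exp_ofReal_mul_I, one_mul]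
  exact (norm_add_le _ _).trans (add_le_add (hC _) (hC _))

theorem continuous_fresnelTrunc (μ R : ℝ) : Continuous (fresnelTrunc μ R) :=
  intervalIntegral.continuous_parametric_intervalIntegral_of_continuous' (by fun_prop) _ _

/-- Integration of the truncated Fresnel integrals against an integrable function. -/
theorem integral_fresnelTrunc_mul {d : ℕ} (ν : Measure (E d)) [SFinite ν] {g : E d → ℂ}
    (hg : Integrable g ν) (μ R : ℝ) (β : E d) :
    ∫ s in (-R)..R, Complex.exp (Complex.I * ((μ * s ^ 2 : ℝ) : ℂ)) *
      ∫ ξ, Complex.exp (Complex.I * ((s * inner ℝ β ξ : ℝ) : ℂ)) * g ξ ∂ν =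
    ∫ ξ, fresnelTrunc μ R (inner ℝ β ξ) * g ξ ∂ν := by
  simp_rw [fresnelTrunc, ← intervalIntegral.integral_mul_const, ← integral_const_mul]
  rw [MeasureTheory.intervalIntegral_integral_swap]
  · simp only [mul_assoc]
  · have hc : Continuous fun p : ℝ × E d => Complex.exp (Complex.I * ((μ * p.1 ^ 2 : ℝ) : ℂ)) *
        Complex.exp (Complex.I * ((p.1 * inner ℝ β p.2 : ℝ) : ℂ)) := by fun_prop
    have : IsFiniteMeasure (volume.restrict (Set.uIoc (-R) R)) := ⟨by simp [Set.uIoc]⟩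
    have h1 : Integrable (fun p : ℝ × E d => g p.2)
        ((volume.restrict (Set.uIoc (-R) R)).prod ν) :=
      hg.comp_snd _
    refine (h1.bdd_mul (c := 1) hc.aestronglyMeasurable (.of_forall fun p => ?_)).congr
      (.of_forall fun p => ?_)
    · rw [norm_mul, mul_comm Complex.I, mul_comm Complex.I, Complex.norm_exp_ofReal_mul_I,
        Complex.norm_exp_ofReal_mul_I, one_mul]
    · simp [Function.uncurry, mul_assoc]

theorem tendsto_integral_fresnelTrunc_mul {d : ℕ} (ν : Measure (E d)) {g : E d → ℂ}
    (hg : Integrable g ν) {μ : ℝ} (hμ : μ ≠ 0) (β : E d) :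
    Tendsto (fun R => ∫ ξ, fresnelTrunc μ R (inner ℝ β ξ) * g ξ ∂ν) atTop
      (𝓝 (fresnelConst μ * ∫ ξ, Complex.exp
        (Complex.I * ((-(1 / (4 * μ) * inner ℝ β ξ ^ 2) : ℝ) : ℂ)) * g ξ ∂ν)) := by
  obtain ⟨C, hC⟩ := exists_norm_fresnelTrunc_le hμ
  rw [← integral_const_mul]
  refine tendsto_integral_filter_of_dominated_convergence (fun ξ => C * ‖g ξ‖)
    (.of_forall fun R => ?_) (.of_forall fun R => .of_forall fun ξ => ?_) (hg.norm.const_mul C)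
    (.of_forall fun ξ => ?_)
  · exact (((continuous_fresnelTrunc μ R).comp (by fun_prop)).aestronglyMeasurable).mul hg.1
  · rw [norm_mul]
    gcongr
    exact hC _ _
  · rw [← mul_assoc]
    exact (tendsto_fresnelTrunc hμ _).mul_const _

/-! ### Diagonalization of `β·y - α·D_y` -/

/-- `V` is an `L²`-isometric automorphism of the Schwartz space that conjugates `β·y - α·D_y` to
multiplication by the linear form `β'·y`. -/
structure Diagonalizes {d : ℕ} (α β β' : E d) (V : 𝓢(E d, ℂ) ≃ₗ[ℂ] 𝓢(E d, ℂ)) : Prop where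
  norm : ∀ φ, ‖toL2 (V φ)‖ = ‖toL2 φ‖
  dual : ∃ V' : 𝓢(E d, ℂ) → 𝓢(E d, ℂ), Function.Surjective V' ∧
    ∀ φ χ, ∫ y, V φ y * χ y = ∫ ξ, φ ξ * V' χ ξ
  exp : ∀ (s : ℝ) (φ), expLin α β s (V φ) =
    V (phaseMul (fun ξ => s * inner ℝ β' ξ) (by fun_prop) φ)
  lin_conj : ∀ a b, ∃ a' b', inner ℝ b' β' = inner ℝ a α + inner ℝ b β ∧
    ∀ φ, lin a b (V φ) = V (lin a' b' φ)
  gen : ∀ φ, lin β (-α) (V φ) = V (lin β' 0 φ)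
  eval : ∀ y, ∃ (ν : Measure (E d)) (_ : SFinite ν) (k : E d → ℂ),
    ∀ φ, Integrable (fun ξ => φ ξ * k ξ) ν ∧ V φ y = ∫ ξ, φ ξ * k ξ ∂ν

theorem diagonalizes_refl {d : ℕ} (β : E d) :
    Diagonalizes 0 β β (LinearEquiv.refl ℂ 𝓢(E d, ℂ)) where
  norm _ := rfl
  dual := ⟨id, Function.surjective_id, fun _ _ => rfl⟩
  exp s φ := by
    funext y
    simp [expLin, phaseMul_apply]
  lin_conj a b := ⟨a, b, by simp, fun _ => rfl⟩
  gen φ := by simp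
  -- No transform is performed here, so the point value is an integral against the Dirac mass.
  -- Allowing a general measure treats this case and the Fourier case together.
  eval y := ⟨Measure.dirac y, inferInstance, 1, fun φ => ⟨by
    simpa using! integrable_dirac (f := φ) (by simp), by simp⟩⟩

/-- A quadratic form with gradient `β` at `α`, so that `exp(i q)` conjugates
`β·y - α·D_y` to `-α·D_y`. -/
def shearPhase {d : ℕ} (α β y : E d) : ℝ :=
  inner ℝ β y * inner ℝ α y / inner ℝ α α -
    inner ℝ α β * inner ℝ α y ^ 2 / (2 * inner ℝ α α ^ 2)

theorem hasTemperateGrowth_shearPhase {d : ℕ} (α β : E d) :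
    (shearPhase α β).HasTemperateGrowth := by
  unfold shearPhase
  simp only [div_eq_mul_inv]
  fun_prop

/-- The derivative of `shearPhase` in the direction `b` is the linear form given by this vector. -/
def shearGrad {d : ℕ} (α β b : E d) : E d :=
  (inner ℝ β b / inner ℝ α α) • α + (inner ℝ α b / inner ℝ α α) • β -
    (inner ℝ α β * inner ℝ α b / inner ℝ α α ^ 2) • α

/-- The phase is a quadratic form, so its second order Taylor expansion is exact. At `b = α`, `t =
-s` it reproduces the phases `s β·y` and `-s² α·β/2` of `expLin`. -/
theorem shearPhase_add_smul {d : ℕ} (α β y b : E d) (t : ℝ) :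
    shearPhase α β (y + t • b) =
      shearPhase α β y + t * inner ℝ (shearGrad α β b) y + t ^ 2 * shearPhase α β b := by
  simp only [shearPhase, shearGrad, inner_add_right, inner_smul_right, inner_add_left,
    inner_sub_left, inner_smul_left, RCLike.conj_to_real]
  ring

theorem hasLineDerivAt_shearPhase {d : ℕ} (α β y b : E d) :
    HasLineDerivAt ℝ (shearPhase α β) (inner ℝ (shearGrad α β b) y) y b := by
  have h : HasDerivAt (fun t : ℝ => shearPhase α β y + t * inner ℝ (shearGrad α β b) y +
      t ^ 2 * shearPhase α β b) (inner ℝ (shearGrad α β b) y) 0 := by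
    have := (((hasDerivAt_id (0 : ℝ)).mul_const (inner ℝ (shearGrad α β b) y)).const_add
      (shearPhase α β y)).add (((hasDerivAt_id (0 : ℝ)).pow 2).mul_const (shearPhase α β b))
    simpa using! this
  exact h.congr_of_eventuallyEq (.of_forall fun t => shearPhase_add_smul α β y b t)

theorem shearGrad_self {d : ℕ} {α : E d} (hα : α ≠ 0) (β : E d) : shearGrad α β α = β := by
  have h : inner ℝ α α ≠ 0 := inner_self_ne_zero.2 hα
  rw [shearGrad, real_inner_comm α β, div_self h, one_smul, add_comm, add_sub_assoc,
    add_eq_left, sub_eq_zero]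
  congr 1
  field_simp

/-- The polar form of a quadratic form is symmetric, and its value against `α` is `β` by
`shearGrad_self`. -/
theorem inner_shearGrad_left {d : ℕ} {α : E d} (hα : α ≠ 0) (β b : E d) :
    inner ℝ (shearGrad α β b) α = inner ℝ b β := by
  have h : inner ℝ α α ≠ 0 := inner_self_ne_zero.2 hα
  simp only [shearGrad, inner_add_left, inner_sub_left, inner_smul_left, RCLike.conj_to_real,
    real_inner_comm α β, real_inner_comm b β]
  field_simp
  ring

theorem shearPhase_self {d : ℕ} {α : E d} (hα : α ≠ 0) (β : E d) :
    shearPhase α β α = inner ℝ α β / 2 := by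
  have h : inner ℝ α α ≠ 0 := inner_self_ne_zero.2 hα
  simp only [shearPhase, real_inner_comm α β]
  field_simp
  ring

theorem fourierInv_apply_eq_integral {d : ℕ} (φ : 𝓢(E d, ℂ)) (y : E d) :
    (FourierTransform.fourierInv φ : 𝓢(E d, ℂ)) y =
      ∫ ξ, φ ξ * Complex.exp (Complex.I * ((2 * Real.pi * inner ℝ ξ y : ℝ) : ℂ)) := by
  rw [SchwartzMap.fourierInv_coe, Real.fourierInv_eq']
  refine integral_congr_ae (.of_forall fun ξ => ?_)
  simp [mul_comm]

theorem fourierInv_sub_smul {d : ℕ} (α : E d) (s : ℝ) (φ : 𝓢(E d, ℂ)) (y : E d) :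
    (FourierTransform.fourierInv φ : 𝓢(E d, ℂ)) (y - s • α) =
      (FourierTransform.fourierInv (phaseMul (fun ξ => s * inner ℝ (-(2 * Real.pi) • α) ξ)
        (by fun_prop) φ) : 𝓢(E d, ℂ)) y := by
  rw [fourierInv_apply_eq_integral, fourierInv_apply_eq_integral]
  refine integral_congr_ae (.of_forall fun ξ => ?_)
  simp only [phaseMul_apply]
  rw [mul_right_comm (Complex.exp _), ← Complex.exp_add, ← mul_add, ← Complex.ofReal_add,
    mul_comm (φ ξ)]
  congr 4
  simp only [inner_sub_right, inner_smul_right, inner_smul_left, RCLike.conj_to_real,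
    real_inner_comm α ξ]
  ring

/-- The Fourier inversion on the Schwartz space followed by multiplication by a phase. -/
def shearFourier {d : ℕ} (α β : E d) : 𝓢(E d, ℂ) ≃ₗ[ℂ] 𝓢(E d, ℂ) :=
  (FourierTransform.fourierCLE ℂ 𝓢(E d, ℂ)).symm.toLinearEquiv ≪≫ₗ
    phaseMul (shearPhase α β) (hasTemperateGrowth_shearPhase α β)

theorem shearFourier_apply {d : ℕ} (α β : E d) (φ : 𝓢(E d, ℂ)) :
    shearFourier α β φ = phaseMul (shearPhase α β) (hasTemperateGrowth_shearPhase α β)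
      (FourierTransform.fourierInv φ) := rfl

theorem norm_toL2_fourierInv {d : ℕ} (φ : 𝓢(E d, ℂ)) :
    ‖toL2 (FourierTransform.fourierInv φ : 𝓢(E d, ℂ))‖ = ‖toL2 φ‖ := by
  have := SchwartzMap.norm_fourier_toL2_eq (FourierTransform.fourierInv φ : 𝓢(E d, ℂ))
  rw [FourierTransform.fourier_fourierInv_eq] at this
  exact this.symm

theorem diagonalizes_shearFourier {d : ℕ} {α : E d} (hα : α ≠ 0) (β : E d) :
    Diagonalizes α β (-(2 * Real.pi) • α) (shearFourier α β) where
  norm φ := by rw [shearFourier_apply, norm_toL2_phaseMul, norm_toL2_fourierInv]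
  dual := by
    refine ⟨fun χ => FourierTransform.fourierInv
      (phaseMul (shearPhase α β) (hasTemperateGrowth_shearPhase α β) χ),
      (FourierTransform.fourierCLE ℂ 𝓢(E d, ℂ)).symm.surjective.comp (LinearEquiv.surjective _),
      fun φ χ => ?_⟩
    rw [← SchwartzMap.integral_fourierInv_mul_eq]
    refine integral_congr_ae (.of_forall fun y => ?_)
    simp only [shearFourier_apply, phaseMul_apply]
    ring
  exp s φ := by
    funext y
    rw [shearFourier_apply, shearFourier_apply, phaseMul_apply, ← fourierInv_sub_smul, expLin,
      phaseMul_apply, ← mul_assoc, ← Complex.exp_add, ← Complex.exp_add]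
    congr 2
    have h := shearPhase_add_smul α β y α (-s)
    rw [shearGrad_self hα, shearPhase_self hα, neg_smul, ← sub_eq_add_neg] at h
    rw [h]
    push_cast
    ring
  lin_conj a b := by
    refine ⟨(2 * Real.pi) • b, -(2 * Real.pi)⁻¹ • (a + shearGrad α β b), ?_, fun φ => ?_⟩
    · simp only [inner_smul_left, inner_smul_right, RCLike.conj_to_real, inner_add_left,
        inner_shearGrad_left hα]
      have := Real.pi_ne_zero
      field_simp
    · rw [shearFourier_apply, shearFourier_apply, lin_phaseMul _ _ _ _ _
        fun y => hasLineDerivAt_shearPhase α β y b, lin_fourierInv]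
  gen φ := by
    have h : shearGrad α β (-α) = -β := by
      conv_rhs => rw [← shearGrad_self hα β]
      simp only [shearGrad, inner_neg_right, neg_div, mul_neg, neg_smul]
      module
    rw [shearFourier_apply, shearFourier_apply, lin_phaseMul _ _ _ _ _
      fun y => hasLineDerivAt_shearPhase α β y (-α), lin_fourierInv, h]
    simp
  eval y := by
    refine ⟨volume, inferInstance, fun ξ => Complex.exp (Complex.I * (shearPhase α β y : ℂ)) *
      Complex.exp (Complex.I * ((2 * Real.pi * inner ℝ ξ y : ℝ) : ℂ)), fun φ => ⟨?_, ?_⟩⟩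
    · refine φ.integrable.mul_bdd (c := 1) (by fun_prop) (.of_forall fun ξ => ?_)
      rw [norm_mul, mul_comm Complex.I, mul_comm Complex.I, Complex.norm_exp_ofReal_mul_I,
        Complex.norm_exp_ofReal_mul_I, one_mul]
    · rw [shearFourier_apply, phaseMul_apply, fourierInv_apply_eq_integral, ← integral_const_mul]
      refine integral_congr_ae (.of_forall fun ξ => ?_)
      simp only
      ring

/-- Each property of the diagonalization has one use: `dual` moves the weak limit to the diagonal
side, and its surjectivity makes every test function available there; `eval` gives pointwise limits;
`lin_conj` keeps the scalar `a·α + b·β`, which up to `i` is the commutator of `L` with `a·y +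
b·D_y`. -/
theorem exists_diagonalizes {d : ℕ} (α β : E d) : ∃ β' V, Diagonalizes α β β' V := by
  by_cases hα : α = 0
  · subst hα
    exact ⟨_, _, diagonalizes_refl β⟩
  · exact ⟨_, _, diagonalizes_shearFourier hα β⟩

/-! ### The transfer operator in the diagonal representation -/

theorem norm_expLin {d : ℕ} (α β : E d) (s : ℝ) (f : E d → ℂ) (y : E d) :
    ‖expLin α β s f y‖ = ‖f (y - s • α)‖ := by
  rw [expLin, norm_mul, norm_mul, ← mul_neg, ← Complex.ofReal_neg, mul_comm Complex.I,
    mul_comm Complex.I, Complex.norm_exp_ofReal_mul_I, Complex.norm_exp_ofReal_mul_I, one_mul,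
    one_mul]

theorem integral_transferTrunc_mul {d : ℕ} (μ : ℝ) (α β : E d) (R : ℝ) (φ χ : 𝓢(E d, ℂ)) :
    ∫ y, transferTrunc μ α β R φ y * χ y =
      ∫ s in (-R)..R, Complex.exp (Complex.I * ((μ * s ^ 2 : ℝ) : ℂ)) *
        ∫ y, expLin α β s φ y * χ y := by
  simp_rw [transferTrunc, ← intervalIntegral.integral_mul_const, ← integral_const_mul]
  rw [intervalIntegral_integral_swap]
  · simp only [mul_assoc]
  · have : IsFiniteMeasure (volume.restrict (Set.uIoc (-R) R)) := ⟨by simp [Set.uIoc]⟩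
    have hc : Continuous fun p : ℝ × E d => Complex.exp (Complex.I * ((μ * p.1 ^ 2 : ℝ) : ℂ)) *
        expLin α β p.1 φ p.2 := by
      unfold expLin
      fun_prop
    have h1 : Integrable (fun p : ℝ × E d => χ p.2)
        ((volume.restrict (Set.uIoc (-R) R)).prod volume) := χ.integrable.comp_snd _
    refine (h1.bdd_mul (c := SchwartzMap.seminorm ℝ 0 0 φ) hc.aestronglyMeasurable
      (.of_forall fun p => ?_)).congr (.of_forall fun p => ?_)
    · rw [norm_mul, norm_expLin, mul_comm Complex.I, Complex.norm_exp_ofReal_mul_I, one_mul]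
      exact φ.norm_le_seminorm ℝ _
    · simp [Function.uncurry, mul_assoc]

/-- The group generated by the square of the operator diagonalized by `V`. -/
def propagator {d : ℕ} (β' : E d) (V : 𝓢(E d, ℂ) ≃ₗ[ℂ] 𝓢(E d, ℂ)) (t : ℝ) :
    𝓢(E d, ℂ) ≃ₗ[ℂ] 𝓢(E d, ℂ) :=
  V.symm ≪≫ₗ phaseMul (fun ξ => -(t * inner ℝ β' ξ ^ 2)) (by fun_prop) ≪≫ₗ V

theorem propagator_map {d : ℕ} (β' : E d) (V : 𝓢(E d, ℂ) ≃ₗ[ℂ] 𝓢(E d, ℂ)) (t : ℝ)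
    (φ : 𝓢(E d, ℂ)) : propagator β' V t (V φ) =
      V (phaseMul (fun ξ => -(t * inner ℝ β' ξ ^ 2)) (by fun_prop) φ) := by
  simp [propagator]

namespace Diagonalizes

variable {d : ℕ} {α β β' : E d} {V : 𝓢(E d, ℂ) ≃ₗ[ℂ] 𝓢(E d, ℂ)}

/-- Transposing `V` puts the factor `exp(is β'·ξ)` under a scalar integral, and Fubini carries out
the `s` integration first. No condition on `μ` enters, so the formula also serves the negative
result at `μ = 0`. -/
theorem exists_integral_transferTrunc_mul (hV : Diagonalizes α β β' V) :
    ∃ V' : 𝓢(E d, ℂ) → 𝓢(E d, ℂ), Function.Surjective V' ∧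
      (∀ φ χ, ∫ y, V φ y * χ y = ∫ ξ, φ ξ * V' χ ξ) ∧ ∀ μ R φ χ,
        ∫ y, transferTrunc μ α β R (V φ) y * χ y =
          ∫ ξ, fresnelTrunc μ R (inner ℝ β' ξ) * (φ ξ * V' χ ξ) := by
  obtain ⟨V', hs, hd⟩ := hV.dual
  refine ⟨V', hs, hd, fun μ R φ χ => ?_⟩
  have hi : Integrable (fun ξ => φ ξ * V' χ ξ) := by
    refine (V' χ).integrable.bdd_mul (c := SchwartzMap.seminorm ℝ 0 0 φ)
      φ.continuous.aestronglyMeasurable (.of_forall fun ξ => φ.norm_le_seminorm ℝ ξ)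
  rw [integral_transferTrunc_mul, ← integral_fresnelTrunc_mul volume hi]
  simp only [hV.exp, hd, phaseMul_apply, mul_assoc]

theorem transferTrunc_eq (hV : Diagonalizes α β β' V) (y : E d) :
    ∃ (ν : Measure (E d)) (_ : SFinite ν) (k : E d → ℂ),
      (∀ φ : 𝓢(E d, ℂ), Integrable (fun ξ => φ ξ * k ξ) ν ∧ V φ y = ∫ ξ, φ ξ * k ξ ∂ν) ∧
      ∀ μ R φ, transferTrunc μ α β R (V φ) y =
        ∫ ξ, fresnelTrunc μ R (inner ℝ β' ξ) * (φ ξ * k ξ) ∂ν := by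
  obtain ⟨ν, hν, k, hk⟩ := hV.eval y
  refine ⟨ν, hν, k, hk, fun μ R φ => ?_⟩
  rw [← integral_fresnelTrunc_mul ν (hk φ).1]
  simp only [transferTrunc, hV.exp, (hk _).2, phaseMul_apply, mul_assoc]

theorem isTransfer (hV : Diagonalizes α β β' V) {μ : ℝ} (hμ : μ ≠ 0) (φ : 𝓢(E d, ℂ)) :
    IsTransfer μ α β φ (fresnelConst μ • propagator β' V (1 / (4 * μ)) φ) := by
  obtain ⟨V', -, hd, ht⟩ := hV.exists_integral_transferTrunc_mul
  intro χ
  obtain ⟨φ, rfl⟩ := V.surjective φ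
  have hi : Integrable (fun ξ => φ ξ * V' χ ξ) := by
    refine (V' χ).integrable.bdd_mul (c := SchwartzMap.seminorm ℝ 0 0 φ)
      φ.continuous.aestronglyMeasurable (.of_forall fun ξ => φ.norm_le_seminorm ℝ ξ)
  simp only [ht, propagator_map, smul_apply, smul_eq_mul, mul_assoc]
  rw [integral_const_mul, hd]
  simp only [phaseMul_apply, mul_assoc]
  exact tendsto_integral_fresnelTrunc_mul volume hi hμ β'

theorem tendsto_transferTrunc (hV : Diagonalizes α β β' V) {μ : ℝ} (hμ : μ ≠ 0) (φ : 𝓢(E d, ℂ))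
    (y : E d) : Tendsto (fun R => transferTrunc μ α β R φ y) atTop
      (𝓝 ((fresnelConst μ • propagator β' V (1 / (4 * μ)) φ) y)) := by
  obtain ⟨ν, hν, k, hk, ht⟩ := hV.transferTrunc_eq y
  obtain ⟨φ, rfl⟩ := V.surjective φ
  simp only [ht, propagator_map, smul_apply, smul_eq_mul, (hk _).2]
  simp only [phaseMul_apply, mul_assoc]
  exact tendsto_integral_fresnelTrunc_mul ν (hk φ).1 hμ β'

end Diagonalizes

theorem mapsSchwartz {d : ℕ} {μ : ℝ} (hμ : μ ≠ 0) (α β : E d) : MapsSchwartz μ α β := by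
  obtain ⟨β', V, hV⟩ := exists_diagonalizes α β
  exact fun φ => ⟨_, hV.isTransfer hμ φ⟩

/-! ### Failure at `μ = 0` -/

/-- The fundamental theorem of calculus, multiplied by `x` so that `x = 0` needs no separate
treatment. -/
theorem fresnelTrunc_zero_mul (R x : ℝ) :
    fresnelTrunc 0 R x * (x : ℂ) = -Complex.I * (Complex.exp (Complex.I * ((R * x : ℝ) : ℂ)) -
      Complex.exp (Complex.I * ((-R * x : ℝ) : ℂ))) := by
  have h : ∀ s ∈ Set.uIcc (-R) R, HasDerivAt
      (fun s : ℝ => -Complex.I * Complex.exp (Complex.I * ((s * x : ℝ) : ℂ)))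
      (Complex.exp (Complex.I * ((s * x : ℝ) : ℂ)) * x) s := fun s _ => by
    have h1 : HasDerivAt (fun s : ℝ => ((s * x : ℝ) : ℂ)) (x : ℂ) s := by
      simpa using ((hasDerivAt_id s).mul_const x).ofReal_comp
    refine ((h1.const_mul Complex.I).cexp.const_mul (-Complex.I)).congr_deriv ?_
    linear_combination (-Complex.exp (Complex.I * ((s * x : ℝ) : ℂ)) * x) * Complex.I_sq
  have := intervalIntegral.integral_eq_sub_of_hasDerivAt h
    (Continuous.intervalIntegrable (by fun_prop) _ _)
  rw [intervalIntegral.integral_mul_const] at this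
  simp only [fresnelTrunc, zero_mul, Complex.ofReal_zero, mul_zero, Complex.exp_zero, one_mul]
  rw [this, mul_sub]

theorem tendsto_integral_exp_inner_mul {d : ℕ} {β : E d} (hβ : β ≠ 0) (f : E d → ℂ)
    {l : Filter ℝ} (hl : Tendsto (fun R : ℝ => |R|) l atTop) :
    Tendsto (fun R : ℝ => ∫ ξ, Complex.exp (Complex.I * ((R * inner ℝ β ξ : ℝ) : ℂ)) * f ξ)
      l (𝓝 0) := by
  have hc : Tendsto (fun R : ℝ => (-(R / (2 * Real.pi))) • β) l (cocompact (E d)) := by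
    rw [← Metric.cobounded_eq_cocompact, ← tendsto_norm_atTop_iff_cobounded]
    simp only [norm_smul, norm_neg, norm_div, Real.norm_eq_abs]
    have : 0 < ‖β‖ := norm_pos_iff.2 hβ
    refine (hl.atTop_div_const ?_).atTop_mul_const this
    simp [Real.pi_ne_zero]
  refine ((tendsto_integral_exp_inner_smul_cocompact f).comp hc).congr fun R => ?_
  refine integral_congr_ae (.of_forall fun ξ => ?_)
  simp only [Circle.smul_def, Real.fourierChar_apply, smul_eq_mul, inner_smul_right]
  rw [mul_comm Complex.I, real_inner_comm]
  congr 4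
  have := Real.pi_ne_zero
  field_simp

theorem eq_zero_of_forall_integral_mul_eq_zero {d : ℕ} {ψ : 𝓢(E d, ℂ)}
    (h : ∀ χ : 𝓢(E d, ℂ), ∫ y, ψ y * χ y = 0) : ψ = 0 := by
  have hae : ∀ᵐ y, ψ y = 0 := by
    refine ae_eq_zero_of_integral_contDiff_smul_eq_zero ψ.integrable.locallyIntegrable
      fun g hg hc => ?_
    have hg' : ContDiff ℝ ∞ fun y => (g y : ℂ) := Complex.ofRealCLM.contDiff.comp hg
    rw [← h ((hc.comp_left Complex.ofReal_zero).toSchwartzMap hg')]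
    refine integral_congr_ae (.of_forall fun y => ?_)
    simp [mul_comm]
  ext y
  exact congrFun ((Continuous.ae_eq_iff_eq volume ψ.continuous continuous_const).1 hae) y

/-- The function vanishes off the hyperplane `β·y = 0`; a point of the hyperplane is approached
along `β`, and continuity concludes. -/
theorem eq_zero_of_lin_eq_zero {d : ℕ} {β : E d} (hβ : β ≠ 0) {ψ : 𝓢(E d, ℂ)}
    (h : lin β 0 ψ = 0) : ψ = 0 := by
  have h0 : ∀ y, inner ℝ β y ≠ 0 → ψ y = 0 := fun y hy => by
    have := DFunLike.congr_fun h y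
    simpa [lin_apply, hy] using this
  ext y
  by_cases hy : inner ℝ β y = 0
  · have hc : Tendsto (fun t : ℝ => ψ (y + t • β)) (𝓝[≠] 0) (𝓝 (ψ y)) := by
      have : Continuous fun t : ℝ => ψ (y + t • β) := by fun_prop
      simpa using (this.tendsto 0).mono_left nhdsWithin_le_nhds
    refine tendsto_nhds_unique hc (tendsto_const_nhds.congr' ?_)
    filter_upwards [self_mem_nhdsWithin] with t ht
    exact (h0 _ (by simpa [inner_add_right, hy, inner_smul_right, hβ] using ht)).symm
  · exact h0 y hy

/-- The standard Gaussian `exp(-‖x‖²/2)`. -/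
def stdGaussian (d : ℕ) : 𝓢(E d, ℂ) :=
  expSchwartz (fun x => ((-(1 / 2) * ‖x‖ ^ 2 : ℝ) : ℂ))
    (Function.Complex.hasTemperateGrowth_ofReal.comp ((Function.HasTemperateGrowth.const _).mul
      (Function.hasTemperateGrowth_norm_sq _))) (1 / 2) (by norm_num) fun x => by
        rw [Complex.ofReal_re]

theorem integral_fresnelTrunc_mul_stdGaussian {d : ℕ} (R : ℝ) (β : E d) :
    ∫ ξ, fresnelTrunc 0 R (inner ℝ β ξ) * (stdGaussian d ξ * stdGaussian d ξ) =
      (Real.pi : ℂ) ^ (d / 2 : ℂ) *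
        ((∫ s in (-R)..R, Real.exp (-(s ^ 2 * ‖β‖ ^ 2 / 4)) : ℝ) : ℂ) := by
  have hi : Integrable (fun ξ => stdGaussian d ξ * stdGaussian d ξ) :=
    (stdGaussian d).integrable.bdd_mul (c := SchwartzMap.seminorm ℝ 0 0 (stdGaussian d))
      (stdGaussian d).continuous.aestronglyMeasurable
      (.of_forall fun ξ => (stdGaussian d).norm_le_seminorm ℝ ξ)
  rw [← integral_fresnelTrunc_mul volume hi, ← intervalIntegral.integral_ofReal,
    ← intervalIntegral.integral_const_mul]
  refine intervalIntegral.integral_congr fun s _ => ?_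
  -- The square of the standard Gaussian is `exp(-‖ξ‖²)`, hence `b = 1`; its Fourier transform at
  -- `sβ` is a positive Gaussian in `s`.
  have := GaussianFourier.integral_cexp_neg_mul_sq_norm_add (V := E d) (b := 1)
    (by simp) (Complex.I * s) β
  simp only [stdGaussian, expSchwartz_apply, ← Complex.exp_add]
  simp only [zero_mul, Complex.ofReal_zero, mul_zero, Complex.exp_zero, one_mul]
  rw [finrank_euclideanSpace_fin, div_one] at this
  refine (integral_congr_ae (.of_forall fun ξ => ?_)).trans (this.trans ?_)
  · congr 1
    push_cast
    ring
  · rw [Complex.ofReal_exp]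
    congr 2
    push_cast
    rw [mul_pow, Complex.I_sq]
    ring

/-- For `c > 0` the integrals are at least their value at `R = 1`, which is positive, so the limit
cannot be zero. For `c = 0` they equal `2R` and have no finite limit at all, whatever `L` is. -/
theorem not_tendsto_integral_exp (c L : ℝ) (hc : 0 < c → L = 0) (hc0 : 0 ≤ c) :
    ¬ Tendsto (fun R : ℝ => ∫ s in (-R)..R, Real.exp (-(s ^ 2 * c))) atTop (𝓝 L) := by
  intro h
  have hi : ∀ a b : ℝ, IntervalIntegrable (fun s : ℝ => Real.exp (-(s ^ 2 * c))) volume a b :=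
    fun a b => Continuous.intervalIntegrable (by fun_prop) _ _
  rcases hc0.lt_or_eq with h0 | h0
  · rw [hc h0] at h
    have h1 : 0 < ∫ s in (-1 : ℝ)..1, Real.exp (-(s ^ 2 * c)) :=
      intervalIntegral.intervalIntegral_pos_of_pos (hi _ _) (fun s => Real.exp_pos _)
        (by norm_num)
    refine absurd (ge_of_tendsto h ?_) (not_le.2 h1)
    filter_upwards [eventually_ge_atTop 1] with R hR
    exact intervalIntegral.integral_mono_interval (by linarith) (by norm_num) hR
      (.of_forall fun s => (Real.exp_pos _).le) (hi _ _)
  · subst h0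
    simp only [mul_zero, neg_zero, Real.exp_zero, intervalIntegral.integral_const, smul_eq_mul,
      mul_one, sub_neg_eq_add] at h
    exact not_tendsto_nhds_of_tendsto_atTop (tendsto_id.atTop_add_atTop tendsto_id) L h

theorem not_mapsSchwartz_zero {d : ℕ} (α β : E d) : ¬ MapsSchwartz 0 α β := by
  intro h
  obtain ⟨β', V, hV⟩ := exists_diagonalizes α β
  obtain ⟨V', hs, hd, ht⟩ := hV.exists_integral_transferTrunc_mul
  obtain ⟨ψ, hψ⟩ := h (V (stdGaussian d))
  obtain ⟨ψ, rfl⟩ := V.surjective ψ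
  have hlim : ∀ χ : 𝓢(E d, ℂ), Tendsto (fun R =>
      ∫ ξ, fresnelTrunc 0 R (inner ℝ β' ξ) * (stdGaussian d ξ * χ ξ)) atTop
      (𝓝 (∫ ξ, ψ ξ * χ ξ)) := fun χ => by
    obtain ⟨χ, rfl⟩ := hs χ
    simpa only [ht, hd] using hψ χ
  -- Testing against `(β'·ξ)χ` leaves only the endpoint exponentials at `±R`, which vanish in the
  -- limit by Riemann-Lebesgue. So `(β'·ξ)ψ` is zero as a distribution.
  have hψ0 : β' ≠ 0 → ψ = 0 := fun hβ => by
    refine eq_zero_of_lin_eq_zero hβ (eq_zero_of_forall_integral_mul_eq_zero fun χ => ?_)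
    have h1 := hlim (lin β' 0 χ)
    have h2 : ∫ ξ, lin β' 0 ψ ξ * χ ξ = ∫ ξ, ψ ξ * lin β' 0 χ ξ := by
      refine integral_congr_ae (.of_forall fun ξ => ?_)
      simp only [lin_apply, map_zero]
      ring
    rw [h2]
    refine tendsto_nhds_unique h1 ?_
    have h3 := tendsto_integral_exp_inner_mul hβ (fun ξ => stdGaussian d ξ * χ ξ)
      tendsto_abs_atTop_atTop
    have h4 := tendsto_integral_exp_inner_mul hβ (fun ξ => stdGaussian d ξ * χ ξ)
      (l := atBot) tendsto_abs_atBot_atTop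
    have h5 := ((h3.sub (h4.comp tendsto_neg_atTop_atBot)).const_mul (-Complex.I))
    rw [sub_zero, mul_zero] at h5
    refine h5.congr fun R => ?_
    have hi : Integrable (fun ξ => stdGaussian d ξ * χ ξ) :=
      χ.integrable.bdd_mul (c := SchwartzMap.seminorm ℝ 0 0 (stdGaussian d))
        (stdGaussian d).continuous.aestronglyMeasurable
        (.of_forall fun ξ => (stdGaussian d).norm_le_seminorm ℝ ξ)
    have hie : ∀ R : ℝ, Integrable (fun ξ => Complex.exp
        (Complex.I * ((R * inner ℝ β' ξ : ℝ) : ℂ)) * (stdGaussian d ξ * χ ξ)) := fun R => by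
      refine hi.bdd_mul (c := 1) (by fun_prop) (.of_forall fun ξ => ?_)
      rw [mul_comm Complex.I, Complex.norm_exp_ofReal_mul_I]
    simp only [Function.comp]
    rw [← integral_sub (hie R) (hie (-R)), ← integral_const_mul]
    refine integral_congr_ae (.of_forall fun ξ => ?_)
    simp only [lin_apply, map_zero]
    linear_combination (-(stdGaussian d ξ * χ ξ)) * fresnelTrunc_zero_mul R (inner ℝ β' ξ)
  have hpi : (Real.pi : ℂ) ^ (d / 2 : ℂ) ≠ 0 := by
    simp [Complex.cpow_eq_zero_iff, Real.pi_ne_zero]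
  have h6 := (hlim (stdGaussian d)).const_mul ((Real.pi : ℂ) ^ (d / 2 : ℂ))⁻¹
  simp only [integral_fresnelTrunc_mul_stdGaussian, inv_mul_cancel_left₀ hpi, mul_div_assoc] at h6
  have h7 := (Complex.continuous_re.tendsto _).comp h6
  -- The rate `‖β'‖²/4` is positive exactly when `β' ≠ 0`, and then `ψ = 0` forces the limit to be
  -- zero.
  refine not_tendsto_integral_exp (‖β'‖ ^ 2 / 4) _ (fun hpos => ?_) (by positivity) h7
  have hβ : β' ≠ 0 := fun h => by simp [h] at hpos
  simp [hψ0 hβ]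

/-! ### The unitary group generated by the square of `β·y - α·D_y` -/

theorem linOp_linOp_eq {d : ℕ} (α β : E d) (φ : 𝓢(E d, ℂ)) :
    linOp α β (linOp α β φ) = lin β (-α) (lin β (-α) φ) := by
  rw [linOp_eq_lin, linOp_eq_lin]

theorem denseRange_toL2 (d : ℕ) : DenseRange (toL2 : 𝓢(E d, ℂ) → L2 d) :=
  SchwartzMap.denseRange_toLpCLM (by simp)

/-- The inclusion of the Schwartz space in `L²` as a linear map. -/
def toL2Lin (d : ℕ) : 𝓢(E d, ℂ) →ₗ[ℂ] L2 d :=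
  (SchwartzMap.toLpCLM ℂ ℂ 2 (volume : Measure (E d))).toLinearMap

theorem toL2_sub {d : ℕ} (φ ψ : 𝓢(E d, ℂ)) : toL2 (φ - ψ) = toL2 φ - toL2 ψ :=
  map_sub (toL2Lin d) φ ψ

theorem toL2_smul {d : ℕ} (c : ℂ) (φ : 𝓢(E d, ℂ)) : toL2 (c • φ) = c • toL2 φ := rfl

theorem eq_toL2_of_ae_eq {d : ℕ} {g : L2 d} {φ : 𝓢(E d, ℂ)}
    (h : (g : E d → ℂ) =ᵐ[volume] φ) : g = toL2 φ :=
  Lp.ext (h.trans (φ.coeFn_toLp 2 volume).symm)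

/-- A Taylor bound valid for all real `x`: beyond `|x| = 1` the crude estimate `1 + 1 + |x| ≤ 3x²`
takes over. Globality matters because `x` will be an unbounded multiplier. -/
theorem norm_cexp_I_mul_sub_one_sub_le (x : ℝ) :
    ‖Complex.exp (Complex.I * x) - 1 - Complex.I * x‖ ≤ 3 * x ^ 2 := by
  have hx : ‖Complex.I * (x : ℂ)‖ = |x| := by simp
  rcases le_total |x| 1 with h | h
  · refine (Complex.norm_exp_sub_one_sub_id_le (by rwa [hx])).trans ?_
    rw [hx, sq_abs]
    nlinarith [sq_nonneg x]
  · have h1 : ‖Complex.exp (Complex.I * x)‖ = 1 := by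
      rw [mul_comm, Complex.norm_exp_ofReal_mul_I]
    have h2 := norm_sub_le (Complex.exp (Complex.I * x) - 1) (Complex.I * x)
    have h3 := norm_sub_le (Complex.exp (Complex.I * x)) 1
    rw [hx] at h2
    rw [h1, norm_one] at h3
    have h4 : |x| ≤ x ^ 2 := by rw [← sq_abs]; nlinarith
    linarith

theorem hasDerivAt_zero_of_norm_le {H : Type*} [NormedAddCommGroup H] [NormedSpace ℝ H]
    {f : ℝ → H} {v : H} {C : ℝ} (h : ∀ t, ‖f t - f 0 - t • v‖ ≤ C * t ^ 2) :
    HasDerivAt f v 0 := by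
  rw [hasDerivAt_iff_isLittleO_nhds_zero]
  have h1 : (fun t => f (0 + t) - f 0 - t • v) =O[𝓝 0] fun t : ℝ => t ^ 2 :=
    Asymptotics.IsBigO.of_bound C (.of_forall fun t => by simpa using h t)
  exact h1.trans_isLittleO (Asymptotics.isLittleO_pow_id one_lt_two)

/-- Product rule for a strongly continuous family of isometries. -/
theorem hasDerivAt_isometry_apply {H : Type*} [NormedAddCommGroup H] [NormedSpace ℝ H]
    [NormedSpace ℂ H] [IsScalarTower ℝ ℂ H]
    {A : ℝ → H ≃ₗᵢ[ℂ] H} {a : ℝ → H} {a' b : H} (hA : ∀ f, ContinuousAt (fun t => A t f) 0)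
    (h0 : A 0 a' = a') (ha : HasDerivAt a a' 0) (hb : HasDerivAt (fun t => A t (a 0)) b 0) :
    HasDerivAt (fun t => A t (a t)) (a' + b) 0 := by
  rw [hasDerivAt_iff_isLittleO_nhds_zero] at *
  simp only [zero_add] at *
  -- The increment splits into `A_t` applied to the remainder of `a`, plus `t (A_t a' - a')`, plus
  -- the remainder of `A_t a(0)`. Isometry controls the first, strong continuity the second.
  have h1 : (fun t => A t (a t - a 0 - t • a')) =o[𝓝 0] fun t : ℝ => t :=
    (Asymptotics.isBigO_of_le _ fun t => ((A t).norm_map _).le).trans_isLittleO ha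
  have h2 : (fun t : ℝ => t • (A t a' - a')) =o[𝓝 0] fun t : ℝ => t := by
    have h3 : (fun t => A t a' - a') =o[𝓝 0] fun _ : ℝ => (1 : ℝ) := by
      rw [Asymptotics.isLittleO_one_iff]
      simpa [h0] using (hA a').tendsto.sub_const a'
    simpa using (Asymptotics.isBigO_refl (fun t : ℝ => t) (𝓝 0)).smul_isLittleO h3
  refine ((h1.add h2).add hb).congr_left fun t => ?_
  have h4 : A t (t • a') = t • A t a' := by
    rw [← algebraMap_smul ℂ t a', (A t).map_smul, algebraMap_smul]
  rw [map_sub, map_sub, h4, smul_add, smul_sub]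
  abel

section Propagator

variable {d : ℕ} {α β β' : E d} {V : 𝓢(E d, ℂ) ≃ₗ[ℂ] 𝓢(E d, ℂ)}

theorem propagator_zero (φ : 𝓢(E d, ℂ)) : propagator β' V 0 φ = φ := by
  obtain ⟨φ, rfl⟩ := V.surjective φ
  rw [propagator_map]
  congr 1
  ext y
  simp [phaseMul_apply]

theorem propagator_add (s t : ℝ) (φ : 𝓢(E d, ℂ)) :
    propagator β' V (s + t) φ = propagator β' V s (propagator β' V t φ) := by
  obtain ⟨φ, rfl⟩ := V.surjective φ
  simp only [propagator_map]
  congr 1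
  ext y
  simp only [phaseMul_apply]
  rw [← mul_assoc, ← Complex.exp_add]
  congr 2
  push_cast
  ring

namespace Diagonalizes

theorem norm_propagator (hV : Diagonalizes α β β' V) (t : ℝ) (φ : 𝓢(E d, ℂ)) :
    ‖toL2 (propagator β' V t φ)‖ = ‖toL2 φ‖ := by
  obtain ⟨φ, rfl⟩ := V.surjective φ
  rw [propagator_map, hV.norm, hV.norm, norm_toL2_phaseMul]

/-- In the diagonal picture the Taylor remainder is at most `3t² (β'·ξ)⁴ |φ|`, and `(β'·ξ)⁴ φ` is
again a Schwartz function; this is the constant supplied below. -/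
theorem hasDerivAt_propagator_zero (hV : Diagonalizes α β β' V) (φ : 𝓢(E d, ℂ)) :
    HasDerivAt (fun t => toL2 (propagator β' V t φ))
      (-Complex.I • toL2 (lin β (-α) (lin β (-α) φ))) 0 := by
  obtain ⟨φ, rfl⟩ := V.surjective φ
  refine hasDerivAt_zero_of_norm_le (C := 3 * ‖toL2 (lin β' 0 (lin β' 0
    (lin β' 0 (lin β' 0 φ))))‖) fun t => ?_
  rw [propagator_zero, hV.gen, hV.gen, ← algebraMap_smul ℂ t, Complex.coe_algebraMap, smul_smul, ← toL2_smul, ← toL2_sub,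
    ← toL2_sub, propagator_map, ← map_sub, ← map_smul, ← map_sub, hV.norm, mul_right_comm]
  refine norm_toL2_le fun y => ?_
  have h := norm_cexp_I_mul_sub_one_sub_le (-(t * inner ℝ β' y ^ 2))
  simp only [lin_apply, sub_apply, smul_apply, phaseMul_apply, map_zero, mul_zero, sub_zero,
    smul_eq_mul, norm_mul]
  calc _ = ‖Complex.exp (Complex.I * ((-(t * inner ℝ β' y ^ 2) : ℝ) : ℂ)) - 1 -
        Complex.I * ((-(t * inner ℝ β' y ^ 2) : ℝ) : ℂ)‖ * ‖φ y‖ := by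
        rw [← norm_mul]
        congr 1
        push_cast
        ring
    _ ≤ 3 * (-(t * inner ℝ β' y ^ 2)) ^ 2 * ‖φ y‖ := by gcongr
    _ = _ := by
        simp only [Complex.norm_real, Real.norm_eq_abs]
        rw [show ∀ x z : ℝ, 3 * t ^ 2 * (|x| * (|x| * (|x| * (|x| * z)))) =
          3 * t ^ 2 * ((|x| ^ 2) ^ 2 * z) from fun x z => by ring, sq_abs]
        ring

theorem hasDerivAt_propagator (hV : Diagonalizes α β β' V) (φ : 𝓢(E d, ℂ)) (t : ℝ) :
    HasDerivAt (fun t => toL2 (propagator β' V t φ)) (-Complex.I •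
      toL2 (lin β (-α) (lin β (-α) (propagator β' V t φ)))) t := by
  have h := hV.hasDerivAt_propagator_zero (propagator β' V t φ)
  rw [← sub_self t] at h
  refine (h.comp_sub_const t t).congr_of_eventuallyEq (.of_forall fun r => ?_)
  simp only [← propagator_add, sub_add_cancel]

/-- Heisenberg's equation: `[L, a·y + b·D]` is `i(a·α + b·β)`, so the commutator with `L²` is a
multiple of `L`, which the group fixes. In the diagonal picture it is the derivative of the phase
`-t(β'·ξ)²` along `b'`. -/
theorem propagator_lin (hV : Diagonalizes α β β' V) (a b : E d) (t : ℝ) (φ : 𝓢(E d, ℂ)) :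
    propagator β' V t (lin a b φ) = lin a b (propagator β' V t φ) +
      ((2 * t * (inner ℝ a α + inner ℝ b β) : ℝ) : ℂ) •
        lin β (-α) (propagator β' V t φ) := by
  obtain ⟨φ, rfl⟩ := V.surjective φ
  obtain ⟨a', b', h, hab⟩ := hV.lin_conj a b
  have hd : ∀ y, HasLineDerivAt ℝ (fun ξ => -(t * inner ℝ β' ξ ^ 2))
      (inner ℝ (-(2 * t * inner ℝ β' b') • β') y) y b' := fun y => by
    have h1 : HasDerivAt (fun r : ℝ => inner ℝ β' (y + r • b')) (inner ℝ β' b') 0 := by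
      have : ∀ r : ℝ, inner ℝ β' (y + r • b') = inner ℝ β' y + r * inner ℝ β' b' := fun r => by
        rw [inner_add_right, inner_smul_right]
      simp only [this]
      simpa using ((hasDerivAt_id (0 : ℝ)).mul_const (inner ℝ β' b')).const_add (inner ℝ β' y)
    refine ((h1.pow 2).const_mul t).neg.congr_deriv ?_
    simp [inner_smul_left]
    ring
  rw [hab, propagator_map, propagator_map, hab, hV.gen, lin_phaseMul _ _ _ _ _ hd, ← map_smul,
    ← map_add]
  congr 1
  ext y
  simp only [phaseMul_apply, lin_apply, add_apply, smul_apply, smul_eq_mul, inner_add_left,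
    inner_smul_left, RCLike.conj_to_real, map_zero, ← h, real_inner_comm b' β']
  push_cast
  ring

/-- The extension of the propagator to a unitary group on `L²`. -/
def unitary (hV : Diagonalizes α β β' V) (t : ℝ) : L2 d ≃ₗᵢ[ℂ] L2 d :=
  (propagator β' V t).extendOfIsometry (toL2Lin d) (toL2Lin d) (denseRange_toL2 d)
    (denseRange_toL2 d) (hV.norm_propagator t)

theorem unitary_toL2 (hV : Diagonalizes α β β' V) (t : ℝ) (φ : 𝓢(E d, ℂ)) :
    hV.unitary t (toL2 φ) = toL2 (propagator β' V t φ) :=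
  LinearEquiv.extendOfIsometry_eq (f := propagator β' V t) (e₁ := toL2Lin d) (e₂ := toL2Lin d)
    (denseRange_toL2 d) (denseRange_toL2 d) (hV.norm_propagator t) φ

theorem isUnitaryGroup (hV : Diagonalizes α β β' V) :
    IsUnitaryGroup (fun f => linOp α β (linOp α β f)) hV.unitary where
  map_zero f := by
    refine congrFun ((denseRange_toL2 d).equalizer (hV.unitary 0).continuous continuous_id
      (funext fun φ => ?_)) f
    simp [unitary_toL2, propagator_zero]
  map_add s t f := by
    refine congrFun ((denseRange_toL2 d).equalizer (hV.unitary (s + t)).continuous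
      ((hV.unitary s).continuous.comp (hV.unitary t).continuous) (funext fun φ => ?_)) f
    simp [unitary_toL2, propagator_add]
  continuous f := by
    refine continuous_of_uniform_approx_of_continuous fun u hu => ?_
    obtain ⟨ε, hε, hu⟩ := Metric.mem_uniformity_dist.1 hu
    obtain ⟨φ, hφ⟩ := (denseRange_toL2 d).exists_dist_lt f hε
    refine ⟨fun t => hV.unitary t (toL2 φ), ?_, fun t => hu ?_⟩
    · simp only [unitary_toL2]
      exact continuous_iff_continuousAt.2 fun t => (hV.hasDerivAt_propagator φ t).continuousAt
    · rwa [LinearIsometryEquiv.dist_map]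
  generator φ := by
    refine ⟨toL2 (lin β (-α) (lin β (-α) φ)), ?_, ?_⟩
    · rw [linOp_linOp_eq]
      exact SchwartzMap.coeFn_toLp _ 2 volume
    · simp only [unitary_toL2]
      exact hV.hasDerivAt_propagator_zero φ

/-- The curve `U(-t) exp(-itL²) φ` has zero derivative. Since `exp(-itL²) φ` remains a Schwartz
function, only the derivative of `U` on Schwartz functions is needed, and no domain of a
self-adjoint operator appears. -/
theorem eq_unitary (hV : Diagonalizes α β β' V) {U : ℝ → (L2 d ≃ₗᵢ[ℂ] L2 d)}
    (hU : IsUnitaryGroup (fun f => linOp α β (linOp α β f)) U) : U = hV.unitary := by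
  have hconst : ∀ φ t, U (-t) (toL2 (propagator β' V t φ)) = toL2 φ := by
    intro φ t
    have hd : ∀ t, HasDerivAt (fun t => U (-t) (toL2 (propagator β' V t φ))) 0 t := by
      intro t
      -- By the two group laws the curve at time `r` is `U(-t)` applied to `U(-(r-t)) exp(-i(r-t)L²)
      -- φ'`, which reduces differentiation at `t` to differentiation at zero.
      set φ' := propagator β' V t φ with hφ'
      obtain ⟨g, hg, hgd⟩ := hU.generator φ'
      simp only [linOp_linOp_eq] at hg
      obtain rfl := eq_toL2_of_ae_eq hg
      have h1 : HasDerivAt (fun r => U (-r) (toL2 φ'))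
          (Complex.I • toL2 (lin β (-α) (lin β (-α) φ'))) 0 := by
        have hn : HasDerivAt (fun r : ℝ => -r) (-1) 0 := hasDerivAt_neg 0
        rw [← neg_zero] at hgd
        simpa using! hgd.scomp 0 hn
      have h2 := hasDerivAt_isometry_apply (A := fun r => U (-r))
        (a := fun r => toL2 (propagator β' V r φ'))
        (fun f => ((hU.continuous f).comp continuous_neg).continuousAt)
        (by rw [neg_zero, hU.map_zero]) (hV.hasDerivAt_propagator_zero φ')
        (by simpa only [propagator_zero] using h1)
      rw [← add_smul, neg_add_cancel, zero_smul, ← sub_self t] at h2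
      have h3 := h2.comp_sub_const t t
      have h4 := ((U (-t)).toContinuousLinearEquiv.toContinuousLinearMap.restrictScalars
        ℝ).hasFDerivAt.comp_hasDerivAt t h3
      rw [map_zero] at h4
      refine h4.congr_of_eventuallyEq (.of_forall fun r => ?_)
      simp only [Function.comp, hφ', ← propagator_add, sub_add_cancel]
      refine Eq.trans ?_ (hU.map_add (-t) (-(r - t)) _)
      rw [show -t + -(r - t) = -r by ring]
    have := is_const_of_deriv_eq_zero (fun t => (hd t).differentiableAt)
      (fun t => (hd t).deriv) t 0
    simpa [hU.map_zero, propagator_zero] using this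
  funext t
  refine LinearIsometryEquiv.ext fun f => congrFun ((denseRange_toL2 d).equalizer
    (U t).continuous (hV.unitary t).continuous (funext fun φ => ?_)) f
  simp only [Function.comp, unitary_toL2]
  rw [← hconst φ t, ← hU.map_add, add_neg_cancel, hU.map_zero]

end Diagonalizes

end Propagator

/-! ### Weyl quantization of polynomial symbols -/

/-- The operators quantizing the phase space coordinates. -/
def coordOp {d : ℕ} : PhIdx d → 𝓢(E d, ℂ) →ₗ[ℂ] 𝓢(E d, ℂ)
  | Sum.inl k => lin (EuclideanSpace.single k 1) 0
  | Sum.inr j => lin 0 (EuclideanSpace.single j 1)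

/-- The integrand in the definition of `weylOp`. -/
def weylIntegrand {d : ℕ} (p : MvPolynomial (PhIdx d) ℂ) (f : E d → ℂ) (x ξ y : E d) : ℂ :=
  polySymbol p (Sum.elim (fun i => (x i + y i) / 2) (fun i => ξ i)) *
    Complex.exp (Complex.I * ((inner ℝ ξ (x - y) : ℝ) : ℂ)) * f y

/-- `A` is the Weyl quantization of `p` on the Schwartz space, with convergent integrals. -/
structure IsWeyl {d : ℕ} (p : MvPolynomial (PhIdx d) ℂ) (A : 𝓢(E d, ℂ) →ₗ[ℂ] 𝓢(E d, ℂ)) :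
    Prop where
  integrable_inner : ∀ (f : 𝓢(E d, ℂ)) x ξ, Integrable (weylIntegrand p f x ξ)
  integrable_outer : ∀ (f : 𝓢(E d, ℂ)) x, Integrable fun ξ => ∫ y, weylIntegrand p f x ξ y
  weylOp_eq : ∀ (f : 𝓢(E d, ℂ)) x, weylOp (polySymbol p) f x = A f x

section

variable {d : ℕ} {p q : MvPolynomial (PhIdx d) ℂ} {A B : 𝓢(E d, ℂ) →ₗ[ℂ] 𝓢(E d, ℂ)}

theorem weylOp_eq_integral (p : MvPolynomial (PhIdx d) ℂ) (f : E d → ℂ) (x : E d) :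
    weylOp (polySymbol p) f x =
      (((2 * Real.pi) ^ d)⁻¹ : ℝ) * ∫ ξ, ∫ y, weylIntegrand p f x ξ y := rfl

namespace IsWeyl

theorem unique (hA : IsWeyl p A) (hB : IsWeyl p B) : A = B := by
  ext f x
  rw [← hA.weylOp_eq, hB.weylOp_eq]

/-- Only the `y` integrals need comparing: the `ξ` integrability and the value are then those of `A`
at `T f`. -/
theorem of_inner_eq (hA : IsWeyl p A) {T : 𝓢(E d, ℂ) →ₗ[ℂ] 𝓢(E d, ℂ)}
    (hi : ∀ (f : 𝓢(E d, ℂ)) x ξ, Integrable (weylIntegrand q f x ξ))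
    (h : ∀ (f : 𝓢(E d, ℂ)) x ξ, ∫ y, weylIntegrand q f x ξ y =
      ∫ y, weylIntegrand p (T f) x ξ y) : IsWeyl q (A ∘ₗ T) where
  integrable_inner := hi
  integrable_outer f x := by simpa only [h] using hA.integrable_outer (T f) x
  weylOp_eq f x := by
    rw [weylOp_eq_integral]
    simp only [h]
    exact hA.weylOp_eq (T f) x

theorem add (hA : IsWeyl p A) (hB : IsWeyl q B) : IsWeyl (p + q) (A + B) := by
  have h : ∀ (f : E d → ℂ) x ξ y, weylIntegrand (p + q) f x ξ y =
      weylIntegrand p f x ξ y + weylIntegrand q f x ξ y := fun f x ξ y => by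
    simp only [weylIntegrand, polySymbol, map_add]
    ring
  have h' : ∀ (f : 𝓢(E d, ℂ)) x ξ, ∫ y, weylIntegrand (p + q) f x ξ y =
      (∫ y, weylIntegrand p f x ξ y) + ∫ y, weylIntegrand q f x ξ y := fun f x ξ => by
    simp only [h]
    exact integral_add (hA.integrable_inner f x ξ) (hB.integrable_inner f x ξ)
  refine ⟨fun f x ξ => ?_, fun f x => ?_, fun f x => ?_⟩
  · exact ((hA.integrable_inner f x ξ).add (hB.integrable_inner f x ξ)).congr
      (.of_forall fun y => (h f x ξ y).symm)
  · simp only [h']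
    exact (hA.integrable_outer f x).add (hB.integrable_outer f x)
  · rw [weylOp_eq_integral]
    simp only [h']
    rw [integral_add (hA.integrable_outer f x) (hB.integrable_outer f x), mul_add,
      LinearMap.add_apply, add_apply, ← hA.weylOp_eq, ← hB.weylOp_eq]
    rfl

theorem C_mul (hA : IsWeyl p A) (c : ℂ) : IsWeyl (MvPolynomial.C c * p) (c • A) := by
  have h : ∀ (f : E d → ℂ) x ξ y, weylIntegrand (MvPolynomial.C c * p) f x ξ y =
      c * weylIntegrand p f x ξ y := fun f x ξ y => by
    simp only [weylIntegrand, polySymbol, map_mul, MvPolynomial.eval_C]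
    ring
  refine ⟨fun f x ξ => ?_, fun f x => ?_, fun f x => ?_⟩
  · exact ((hA.integrable_inner f x ξ).const_mul c).congr
      (.of_forall fun y => (h f x ξ y).symm)
  · simp only [h, integral_const_mul]
    exact (hA.integrable_outer f x).const_mul c
  · rw [weylOp_eq_integral]
    simp only [h, integral_const_mul]
    rw [mul_left_comm, LinearMap.smul_apply, smul_apply, smul_eq_mul, ← hA.weylOp_eq]
    rfl

/-- The midpoint coordinate is `(x_k + y_k)/2`: the half with `x_k` leaves the integral and
multiplies on the left, the half with `y_k` is absorbed into `f` and multiplies on the right. -/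
theorem X_inl_mul (hA : IsWeyl p A) (k : Fin d) : IsWeyl (MvPolynomial.X (Sum.inl k) * p)
    ((1 / 2 : ℂ) • (coordOp (Sum.inl k) ∘ₗ A + A ∘ₗ coordOp (Sum.inl k))) := by
  have h : ∀ (f : 𝓢(E d, ℂ)) x ξ y, weylIntegrand (MvPolynomial.X (Sum.inl k) * p) f x ξ y =
      (1 / 2 : ℂ) * (x k * weylIntegrand p f x ξ y +
        weylIntegrand p (coordOp (Sum.inl k) f) x ξ y) := fun f x ξ y => by
    simp only [weylIntegrand, polySymbol, map_mul, MvPolynomial.eval_X, Sum.elim_inl, coordOp,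
      lin_apply, map_zero, EuclideanSpace.inner_single_left, map_one]
    push_cast
    ring
  have hi : ∀ (f : 𝓢(E d, ℂ)) x ξ, Integrable fun y => x k * weylIntegrand p f x ξ y :=
    fun f x ξ => (hA.integrable_inner f x ξ).const_mul _
  have ho : ∀ (f : 𝓢(E d, ℂ)) x, Integrable fun ξ => x k * ∫ y, weylIntegrand p f x ξ y :=
    fun f x => (hA.integrable_outer f x).const_mul _
  have h' : ∀ (f : 𝓢(E d, ℂ)) x ξ, ∫ y, weylIntegrand (MvPolynomial.X (Sum.inl k) * p) f x ξ y =
      (1 / 2 : ℂ) * (x k * (∫ y, weylIntegrand p f x ξ y) +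
        ∫ y, weylIntegrand p (coordOp (Sum.inl k) f) x ξ y) := fun f x ξ => by
    simp only [h]
    rw [integral_const_mul, integral_add (hi f x ξ) (hA.integrable_inner _ x ξ),
      integral_const_mul]
  refine ⟨fun f x ξ => ?_, fun f x => ?_, fun f x => ?_⟩
  · exact (((hi f x ξ).add (hA.integrable_inner _ x ξ)).const_mul _).congr
      (.of_forall fun y => (h f x ξ y).symm)
  · simp only [h']
    exact ((ho f x).add (hA.integrable_outer _ x)).const_mul _
  · rw [weylOp_eq_integral]
    simp only [h']
    have h1 := hA.weylOp_eq f x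
    have h2 := hA.weylOp_eq (coordOp (Sum.inl k) f) x
    rw [weylOp_eq_integral] at h1 h2
    have h3 : coordOp (Sum.inl k) (A f) x = x k * A f x := by
      simp [coordOp, lin_apply, EuclideanSpace.inner_single_left]
    rw [integral_const_mul, integral_add (ho f x) (hA.integrable_outer _ x), integral_const_mul]
    simp only [LinearMap.smul_apply, LinearMap.add_apply, LinearMap.comp_apply, smul_apply,
      add_apply, smul_eq_mul, h3, ← h1, ← h2]
    ring

end IsWeyl

theorem integral_weylIntegrand_one (f : 𝓢(E d, ℂ)) (x ξ : E d) :
    ∫ y, weylIntegrand 1 f x ξ y = Complex.exp (Complex.I * ((inner ℝ ξ x : ℝ) : ℂ)) *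
      (FourierTransform.fourier f : 𝓢(E d, ℂ)) ((2 * Real.pi)⁻¹ • ξ) := by
  rw [SchwartzMap.fourier_coe, Real.fourier_eq', ← integral_const_mul]
  refine integral_congr_ae (.of_forall fun y => ?_)
  simp only [weylIntegrand, polySymbol, map_one, one_mul, smul_eq_mul]
  rw [← mul_assoc, ← Complex.exp_add]
  congr 2
  rw [inner_sub_right, inner_smul_right, real_inner_comm y ξ]
  have := Real.pi_ne_zero
  push_cast
  have hpi : (Real.pi : ℂ) ≠ 0 := by exact_mod_cast this
  field_simp
  ring

/-- This is Fourier inversion; the dilation by `(2π)⁻¹` between the two normalizations has a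
Jacobian that cancels `(2π)^{-d}`. -/
theorem isWeyl_one : IsWeyl (1 : MvPolynomial (PhIdx d) ℂ) LinearMap.id := by
  have h2pi : (2 * Real.pi)⁻¹ ≠ 0 := by simp [Real.pi_ne_zero]
  refine ⟨fun f x ξ => ?_, fun f x => ?_, fun f x => ?_⟩
  · refine (f.integrable.bdd_mul (c := 1) (f := fun y =>
      Complex.exp (Complex.I * ((inner ℝ ξ (x - y) : ℝ) : ℂ))) (by fun_prop)
      (.of_forall fun y => ?_)).congr (.of_forall fun y => ?_)
    · rw [mul_comm Complex.I, Complex.norm_exp_ofReal_mul_I]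
    · simp [weylIntegrand, polySymbol]
  · simp only [integral_weylIntegrand_one]
    refine ((FourierTransform.fourier f : 𝓢(E d, ℂ)).integrable.comp_smul h2pi).bdd_mul (c := 1)
      (by fun_prop) (.of_forall fun ξ => ?_)
    rw [mul_comm Complex.I, Complex.norm_exp_ofReal_mul_I]
  · rw [weylOp_eq_integral]
    simp only [integral_weylIntegrand_one]
    have h := Measure.integral_comp_smul (volume : Measure (E d)) (fun ξ : E d =>
      (FourierTransform.fourier f : 𝓢(E d, ℂ)) ξ *
        Complex.exp (Complex.I * ((2 * Real.pi * inner ℝ ξ x : ℝ) : ℂ))) (2 * Real.pi)⁻¹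
    rw [← fourierInv_apply_eq_integral, FourierTransform.fourierInv_fourier_eq,
      finrank_euclideanSpace_fin] at h
    have hpos : 0 < ((2 * Real.pi)⁻¹ ^ d)⁻¹ := by have := Real.pi_pos; positivity
    rw [abs_of_pos hpos, inv_pow, inv_inv] at h
    have h0 : ((2 * Real.pi) ^ d : ℝ) ≠ 0 := by have := Real.pi_pos; positivity
    rw [LinearMap.id_apply, Complex.ofReal_inv, inv_mul_eq_iff_eq_mul₀ (by exact_mod_cast h0),
      ← Complex.real_smul, ← h]
    refine integral_congr_ae (.of_forall fun ξ => ?_)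
    simp only
    rw [mul_comm, inner_smul_left]
    congr 4
    simp only [RCLike.conj_to_real]
    field_simp

theorem weylIntegrand_X_inr_mul (p : MvPolynomial (PhIdx d) ℂ) (j : Fin d) (f : E d → ℂ)
    (x ξ y : E d) : weylIntegrand (MvPolynomial.X (Sum.inr j) * p) f x ξ y =
      ξ j * weylIntegrand p f x ξ y := by
  simp only [weylIntegrand, polySymbol, map_mul, MvPolynomial.eval_X, Sum.elim_inr]
  ring

/-- Integration by parts, in the form of the Fourier transform of a derivative. -/
theorem mul_integral_weylIntegrand_one (j : Fin d) (f : 𝓢(E d, ℂ)) (x ξ : E d) :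
    ξ j * ∫ y, weylIntegrand 1 f x ξ y =
      ∫ y, weylIntegrand 1 (coordOp (Sum.inr j) f) x ξ y := by
  have hpi : (Real.pi : ℂ) ≠ 0 := by exact_mod_cast Real.pi_ne_zero
  have h1 : coordOp (Sum.inr j) f = (-Complex.I) •
      LineDeriv.lineDerivOp (EuclideanSpace.single j (1 : ℝ) : E d) f := by
    ext y
    simp [coordOp, lin_apply, SchwartzMap.lineDerivOp_apply_eq_fderiv]
  have hg : (fun η : E d => inner ℝ η (EuclideanSpace.single j 1)).HasTemperateGrowth := by
    fun_prop
  rw [integral_weylIntegrand_one, integral_weylIntegrand_one, h1, FourierTransform.fourier_smul,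
    SchwartzMap.fourier_lineDerivOp_eq]
  rw [smul_apply, smul_apply, SchwartzMap.smulLeftCLM_apply_apply hg, inner_smul_left,
    EuclideanSpace.inner_single_right, RCLike.conj_to_real, RCLike.conj_to_real, one_mul,
    Complex.real_smul, smul_eq_mul, smul_eq_mul]
  generalize (FourierTransform.fourier f : 𝓢(E d, ℂ)) ((2 * Real.pi)⁻¹ • ξ) = z
  push_cast
  field_simp
  linear_combination (ξ j * z) * Complex.I_sq

/-- Under the inner integrals of the symbol `1` both compositions become multiplication by `ξ_j
ξ_k`. -/
theorem coordOp_inr_comm (j k : Fin d) : coordOp (d := d) (Sum.inr j) ∘ₗ coordOp (Sum.inr k) =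
    coordOp (Sum.inr k) ∘ₗ coordOp (Sum.inr j) := by
  ext f x
  rw [← LinearMap.id_apply (R := ℂ) (x := (coordOp (Sum.inr j) ∘ₗ coordOp (Sum.inr k)) f),
    ← LinearMap.id_apply (R := ℂ) (x := (coordOp (Sum.inr k) ∘ₗ coordOp (Sum.inr j)) f),
    ← isWeyl_one.weylOp_eq, ← isWeyl_one.weylOp_eq, weylOp_eq_integral, weylOp_eq_integral]
  simp only [LinearMap.comp_apply, ← mul_integral_weylIntegrand_one, mul_left_comm (_ : ℂ)]

/-- Quantization of symbols that depend on the momenta only. -/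
theorem exists_isWeyl_rename_inr (r : MvPolynomial (Fin d) ℂ) :
    ∃ A : 𝓢(E d, ℂ) →ₗ[ℂ] 𝓢(E d, ℂ),
      (∀ j, A ∘ₗ coordOp (Sum.inr j) = coordOp (Sum.inr j) ∘ₗ A) ∧
      IsWeyl (MvPolynomial.rename Sum.inr r) A ∧
      ∀ (f : 𝓢(E d, ℂ)) x ξ, ∫ y, weylIntegrand (MvPolynomial.rename Sum.inr r) f x ξ y =
        ∫ y, weylIntegrand 1 (A f) x ξ y := by
  induction r using MvPolynomial.induction_on with
  | C a =>
    have h := (isWeyl_one (d := d)).C_mul a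
    rw [mul_one] at h
    refine ⟨_, fun j => ?_, by rwa [MvPolynomial.rename_C], fun f x ξ => ?_⟩
    · ext f x
      simp
    · rw [MvPolynomial.rename_C]
      refine integral_congr_ae (.of_forall fun y => ?_)
      simp only [weylIntegrand, polySymbol, MvPolynomial.eval_C, map_one, LinearMap.smul_apply,
        LinearMap.id_apply, smul_apply, smul_eq_mul]
      ring
  | add r s hr hs =>
    obtain ⟨A, hA, hiA, heA⟩ := hr
    obtain ⟨B, hB, hiB, heB⟩ := hs
    refine ⟨A + B, fun j => ?_, ?_, fun f x ξ => ?_⟩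
    · rw [LinearMap.add_comp, LinearMap.comp_add, hA, hB]
    · rw [map_add]
      exact hiA.add hiB
    · have h1 : ∀ y, weylIntegrand (MvPolynomial.rename Sum.inr (r + s)) f x ξ y =
          weylIntegrand (MvPolynomial.rename Sum.inr r) f x ξ y +
            weylIntegrand (MvPolynomial.rename Sum.inr s) f x ξ y := fun y => by
        simp only [weylIntegrand, polySymbol, map_add]
        ring
      have h2 : ∀ y, weylIntegrand 1 ((A + B) f) x ξ y =
          weylIntegrand 1 (A f) x ξ y + weylIntegrand 1 (B f) x ξ y := fun y => by
        simp only [weylIntegrand, LinearMap.add_apply, add_apply]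
        ring
      simp only [h1, h2]
      rw [integral_add (hiA.integrable_inner f x ξ) (hiB.integrable_inner f x ξ),
        integral_add (isWeyl_one.integrable_inner _ x ξ) (isWeyl_one.integrable_inner _ x ξ),
        heA, heB]
  | mul_X r j hr =>
    obtain ⟨A, hA, hiA, heA⟩ := hr
    have hr : MvPolynomial.rename (Sum.inr : Fin d → PhIdx d) (r * MvPolynomial.X j) =
        MvPolynomial.X (Sum.inr j) * MvPolynomial.rename Sum.inr r := by
      rw [map_mul, MvPolynomial.rename_X, mul_comm]
    have he : ∀ (f : 𝓢(E d, ℂ)) x ξ,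
        ∫ y, weylIntegrand (MvPolynomial.X (Sum.inr j) * MvPolynomial.rename Sum.inr r) f x ξ y =
          ∫ y, weylIntegrand 1 ((coordOp (Sum.inr j) ∘ₗ A) f) x ξ y := fun f x ξ => by
      simp only [weylIntegrand_X_inr_mul]
      rw [integral_const_mul, heA, mul_integral_weylIntegrand_one, LinearMap.comp_apply]
    rw [hr]
    refine ⟨coordOp (Sum.inr j) ∘ₗ A, fun k => ?_, ?_, he⟩
    · rw [LinearMap.comp_assoc, hA, ← LinearMap.comp_assoc, coordOp_inr_comm, LinearMap.comp_assoc]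
    · refine IsWeyl.of_inner_eq (A := LinearMap.id) isWeyl_one (fun f x ξ => ?_) he
      exact ((hiA.integrable_inner f x ξ).const_mul (ξ j : ℂ)).congr
        (.of_forall fun y => (weylIntegrand_X_inr_mul _ j f x ξ y).symm)

/-- The symmetrized product of operators. -/
def jordan (A B : 𝓢(E d, ℂ) →ₗ[ℂ] 𝓢(E d, ℂ)) : 𝓢(E d, ℂ) →ₗ[ℂ] 𝓢(E d, ℂ) :=
  (1 / 2 : ℂ) • (A ∘ₗ B + B ∘ₗ A)

theorem jordan_apply (A B : 𝓢(E d, ℂ) →ₗ[ℂ] 𝓢(E d, ℂ)) (f : 𝓢(E d, ℂ)) :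
    jordan A B f = (1 / 2 : ℂ) • (A (B f) + B (A f)) := rfl

theorem jordan_add_left (A A' B : 𝓢(E d, ℂ) →ₗ[ℂ] 𝓢(E d, ℂ)) :
    jordan (A + A') B = jordan A B + jordan A' B := by
  ext1 f
  simp only [jordan_apply, LinearMap.add_apply, map_add]
  module

theorem jordan_add_right (A B B' : 𝓢(E d, ℂ) →ₗ[ℂ] 𝓢(E d, ℂ)) :
    jordan A (B + B') = jordan A B + jordan A B' := by
  ext1 f
  simp only [jordan_apply, LinearMap.add_apply, map_add]
  module

theorem jordan_smul_left (c : ℂ) (A B : 𝓢(E d, ℂ) →ₗ[ℂ] 𝓢(E d, ℂ)) :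
    jordan (c • A) B = c • jordan A B := by
  ext1 f
  simp only [jordan_apply, LinearMap.smul_apply, map_smul]
  module

theorem jordan_sum_left {ι : Type*} (s : Finset ι) (A : ι → 𝓢(E d, ℂ) →ₗ[ℂ] 𝓢(E d, ℂ))
    (B : 𝓢(E d, ℂ) →ₗ[ℂ] 𝓢(E d, ℂ)) :
    jordan (∑ i ∈ s, A i) B = ∑ i ∈ s, jordan (A i) B := by
  classical
  induction s using Finset.induction_on with
  | empty => ext1 f; simp [jordan_apply]
  | insert i s hi ih => rw [Finset.sum_insert hi, Finset.sum_insert hi, jordan_add_left, ih]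

/-- Position and momentum operators commute up to a scalar, so that symmetrized products with
them commute. -/
theorem jordan_left_comm (k j : Fin d) (A : 𝓢(E d, ℂ) →ₗ[ℂ] 𝓢(E d, ℂ)) :
    jordan (coordOp (Sum.inl k)) (jordan (coordOp (Sum.inr j)) A) =
      jordan (coordOp (Sum.inr j)) (jordan (coordOp (Sum.inl k)) A) := by
  obtain ⟨c, hc⟩ : ∃ c : ℂ, ∀ f : 𝓢(E d, ℂ), coordOp (Sum.inr j) (coordOp (Sum.inl k) f) =
      coordOp (Sum.inl k) (coordOp (Sum.inr j) f) + c • f := by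
    refine ⟨-Complex.I * ((inner ℝ (EuclideanSpace.single k (1 : ℝ) : E d)
      (EuclideanSpace.single j 1) : ℝ) : ℂ), fun f => ?_⟩
    ext y
    have h1 : HasFDerivAt (fun y : E d => ((inner ℝ (EuclideanSpace.single k (1 : ℝ)) y : ℝ) : ℂ))
        (Complex.ofRealCLM.comp (innerSL ℝ (EuclideanSpace.single k (1 : ℝ)))) y :=
      (Complex.ofRealCLM.comp (innerSL ℝ (EuclideanSpace.single k (1 : ℝ) : E d))).hasFDerivAt
    have h2 : HasFDerivAt (coordOp (Sum.inl k) f) _ y :=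
      (h1.mul f.differentiableAt.hasFDerivAt).congr_of_eventuallyEq
        (.of_forall fun y => by simp [coordOp, lin_apply])
    have h3 := h2.fderiv
    simp only [coordOp] at h3 ⊢
    simp only [lin_apply, h3, add_apply, smul_apply, inner_zero_left, map_zero, smul_eq_mul,
      ContinuousLinearMap.comp_apply, innerSL_apply_apply, Complex.ofRealCLM_apply,
      Complex.ofReal_zero]
    ring
  ext1 f
  simp only [jordan_apply, map_smul, map_add, hc]
  module

/-- Positions are handled by `X_inl_mul`. For a momentum factor, `p` is read as a polynomial in the
positions with coefficients in the momenta. On coefficients everything commutes, so the symmetrized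
product is the ordinary one; position factors are then added one at a time, and `jordan_left_comm`
carries the momentum rule past them. -/
theorem isWeyl_jordan_coordOp (p : MvPolynomial (PhIdx d) ℂ) :
    ∃ A : 𝓢(E d, ℂ) →ₗ[ℂ] 𝓢(E d, ℂ), IsWeyl p A ∧
      ∀ i, IsWeyl (MvPolynomial.X i * p) (jordan (coordOp i) A) := by
  suffices h : ∃ A : 𝓢(E d, ℂ) →ₗ[ℂ] 𝓢(E d, ℂ), IsWeyl p A ∧
      ∀ j, IsWeyl (MvPolynomial.X (Sum.inr j) * p) (jordan (coordOp (Sum.inr j)) A) by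
    obtain ⟨A, hA, hj⟩ := h
    refine ⟨A, hA, fun i => ?_⟩
    rcases i with k | j
    · exact hA.X_inl_mul k
    · exact hj j
  have hsum : ∀ q : MvPolynomial (Fin d) (MvPolynomial (Fin d) ℂ),
      ∃ A : 𝓢(E d, ℂ) →ₗ[ℂ] 𝓢(E d, ℂ),
        IsWeyl ((MvPolynomial.sumAlgEquiv ℂ (Fin d) (Fin d)).symm q) A ∧
        ∀ j, IsWeyl (MvPolynomial.X (Sum.inr j) *
          (MvPolynomial.sumAlgEquiv ℂ (Fin d) (Fin d)).symm q) (jordan (coordOp (Sum.inr j)) A) := by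
    intro q
    induction q using MvPolynomial.induction_on with
    | C r =>
      have hr : (MvPolynomial.sumAlgEquiv ℂ (Fin d) (Fin d)).symm (MvPolynomial.C r) =
          MvPolynomial.rename Sum.inr r := by
        rw [AlgEquiv.symm_apply_eq]
        exact (AlgHom.congr_fun (MvPolynomial.sumAlgEquiv_comp_rename_inr ℂ (Fin d) (Fin d)) r).symm
      obtain ⟨A, hA, hiA, heA⟩ := exists_isWeyl_rename_inr r
      rw [hr]
      refine ⟨A, hiA, fun j => ?_⟩
      have hj : jordan (coordOp (Sum.inr j)) A = coordOp (Sum.inr j) ∘ₗ A := by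
        rw [jordan, hA, ← two_smul ℂ, smul_smul]
        norm_num
      rw [hj, ← LinearMap.id_comp (coordOp (Sum.inr j) ∘ₗ A)]
      refine IsWeyl.of_inner_eq (A := LinearMap.id) isWeyl_one (fun f x ξ => ?_) fun f x ξ => ?_
      · exact ((hiA.integrable_inner f x ξ).const_mul (ξ j : ℂ)).congr
          (.of_forall fun y => (weylIntegrand_X_inr_mul _ j f x ξ y).symm)
      · simp only [weylIntegrand_X_inr_mul]
        rw [integral_const_mul, heA, mul_integral_weylIntegrand_one, LinearMap.comp_apply]
    | add p q hp hq =>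
      obtain ⟨A, hA, hA'⟩ := hp
      obtain ⟨B, hB, hB'⟩ := hq
      refine ⟨A + B, by rw [map_add]; exact hA.add hB, fun j => ?_⟩
      rw [map_add, mul_add, jordan_add_right]
      exact (hA' j).add (hB' j)
    | mul_X q k hq =>
      have hX : (MvPolynomial.sumAlgEquiv ℂ (Fin d) (Fin d)).symm (q * MvPolynomial.X k) =
          MvPolynomial.X (Sum.inl k) * (MvPolynomial.sumAlgEquiv ℂ (Fin d) (Fin d)).symm q := by
        rw [map_mul, MvPolynomial.sumAlgEquiv_symm_X, mul_comm]
      obtain ⟨A, hA, hA'⟩ := hq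
      rw [hX]
      refine ⟨jordan (coordOp (Sum.inl k)) A, hA.X_inl_mul k, fun j => ?_⟩
      -- The position factor is brought outermost, where `X_inl_mul` applies to the symbol already
      -- containing the momentum.
      rw [← jordan_left_comm, mul_left_comm]
      exact (hA' j).X_inl_mul k
  simpa using hsum (MvPolynomial.sumAlgEquiv ℂ (Fin d) (Fin d) p)

theorem exists_isWeyl (p : MvPolynomial (PhIdx d) ℂ) : ∃ A, IsWeyl p A :=
  (isWeyl_jordan_coordOp p).imp fun _ h => h.1

namespace IsWeyl

theorem X_mul (hA : IsWeyl p A) (i : PhIdx d) :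
    IsWeyl (MvPolynomial.X i * p) (jordan (coordOp i) A) := by
  obtain ⟨B, hB, h⟩ := isWeyl_jordan_coordOp p
  exact hA.unique hB ▸ h i

/-- The linear polynomial `w·z`. -/
def _root_.TransferOp.linPoly (w : PhIdx d → ℝ) : MvPolynomial (PhIdx d) ℂ :=
  ∑ k, MvPolynomial.C (w k : ℂ) * MvPolynomial.X k

theorem sum {ι : Type*} (s : Finset ι) {P : ι → MvPolynomial (PhIdx d) ℂ}
    {T : ι → 𝓢(E d, ℂ) →ₗ[ℂ] 𝓢(E d, ℂ)} (h : ∀ i, IsWeyl (P i) (T i)) :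
    IsWeyl (∑ i ∈ s, P i) (∑ i ∈ s, T i) := by
  classical
  induction s using Finset.induction_on with
  | empty => simpa using (isWeyl_one (d := d)).C_mul 0
  | insert i s hi ih =>
    rw [Finset.sum_insert hi, Finset.sum_insert hi]
    exact (h i).add ih

theorem linPoly_mul (hA : IsWeyl p A) (w : PhIdx d → ℝ) :
    IsWeyl (linPoly w * p) (jordan (∑ k, (w k : ℂ) • coordOp k) A) := by
  rw [linPoly, Finset.sum_mul, jordan_sum_left]
  refine sum _ fun k => ?_
  rw [mul_assoc, jordan_smul_left]
  exact (hA.X_mul k).C_mul _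

end IsWeyl

/-! ### Linear substitutions and covariance of the Weyl quantization. -/

theorem eval_linPoly (w z : PhIdx d → ℝ) :
    MvPolynomial.eval (fun i => ((z i : ℝ) : ℂ)) (linPoly w) = ((dotProduct w z : ℝ) : ℂ) := by
  simp [linPoly, dotProduct]

/-- The composition of a polynomial with a linear map of the phase space. -/
def linSubst (M : Matrix (PhIdx d) (PhIdx d) ℝ) :
    MvPolynomial (PhIdx d) ℂ →ₐ[ℂ] MvPolynomial (PhIdx d) ℂ :=
  MvPolynomial.aeval fun i => linPoly (M i)

theorem polySymbol_linSubst (M : Matrix (PhIdx d) (PhIdx d) ℝ) (p : MvPolynomial (PhIdx d) ℂ)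
    (z : PhIdx d → ℝ) : polySymbol (linSubst M p) z = polySymbol p (M.mulVec z) := by
  induction p using MvPolynomial.induction_on with
  | C a => simp [polySymbol, linSubst]
  | add p q hp hq =>
    simp only [polySymbol, map_add] at *
    rw [hp, hq]
  | mul_X p i hp =>
    simp only [polySymbol, map_mul] at *
    rw [hp]
    simp [linSubst, eval_linPoly, Matrix.mulVec]

/-- Covariance of the Weyl quantization: an operator that conjugates the coordinates linearly
conjugates polynomial symbols by the same linear substitution. -/
theorem IsWeyl.map_apply {W : 𝓢(E d, ℂ) →ₗ[ℂ] 𝓢(E d, ℂ)} {M : Matrix (PhIdx d) (PhIdx d) ℝ}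
    (hW : ∀ i, W ∘ₗ coordOp i = (∑ k, (M i k : ℂ) • coordOp k) ∘ₗ W)
    (hA : IsWeyl p A) (hB : IsWeyl (linSubst M p) B) : W ∘ₗ A = B ∘ₗ W := by
  induction p using MvPolynomial.induction_on generalizing A B with
  | C a =>
    have h := (isWeyl_one (d := d)).C_mul a
    rw [mul_one] at h
    have h' : linSubst M (MvPolynomial.C a) = MvPolynomial.C a := by
      simp [linSubst, MvPolynomial.algebraMap_eq]
    rw [h'] at hB
    rw [hA.unique h, hB.unique h, LinearMap.comp_smul, LinearMap.smul_comp]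
    rfl
  | add p q hp hq =>
    obtain ⟨A₁, h₁⟩ := exists_isWeyl p
    obtain ⟨A₂, h₂⟩ := exists_isWeyl q
    obtain ⟨B₁, h₁'⟩ := exists_isWeyl (linSubst M p)
    obtain ⟨B₂, h₂'⟩ := exists_isWeyl (linSubst M q)
    rw [map_add] at hB
    rw [hA.unique (h₁.add h₂), hB.unique (h₁'.add h₂'), LinearMap.comp_add, LinearMap.add_comp,
      hp h₁ h₁', hq h₂ h₂']
  | mul_X p i hp =>
    obtain ⟨A₁, h₁⟩ := exists_isWeyl p
    obtain ⟨B₁, h₁'⟩ := exists_isWeyl (linSubst M p)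
    have h3 : linSubst M (p * MvPolynomial.X i) = linPoly (M i) * linSubst M p := by
      rw [map_mul, mul_comm]
      simp [linSubst]
    rw [mul_comm] at hA
    rw [h3] at hB
    -- Both quantizations are now symmetrized products with a linear operator, and intertwining by
    -- `W` respects such products.
    rw [hA.unique (h₁.X_mul i), hB.unique (h₁'.linPoly_mul (M i))]
    have h4 := hp h₁ h₁'
    ext1 f
    have h5 : ∀ g, W (A₁ g) = B₁ (W g) := fun g => LinearMap.congr_fun h4 g
    have h6 : ∀ g, W (coordOp i g) = (∑ k, (M i k : ℂ) • coordOp k) (W g) :=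
      fun g => LinearMap.congr_fun (hW i) g
    simp only [LinearMap.comp_apply, jordan_apply, map_smul, map_add, h5, h6]

theorem lin_sum {ι : Type*} (s : Finset ι) (a b : ι → E d) :
    lin (∑ i ∈ s, a i) (∑ i ∈ s, b i) = ∑ i ∈ s, lin (a i) (b i) := by
  classical
  induction s using Finset.induction_on with
  | empty => ext f y; simp [lin_apply]
  | insert i s hi ih =>
    rw [Finset.sum_insert hi, Finset.sum_insert hi, Finset.sum_insert hi, lin_add, ih]

theorem sum_coordOp_eq_lin (a b : E d) :
    ∑ k, ((Sum.elim (fun i => a i) (fun i => b i) k : ℝ) : ℂ) • coordOp k = lin a b := by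
  have h : ∀ c : E d, ∑ i, c i • (EuclideanSpace.single i (1 : ℝ) : E d) = c := fun c => by
    ext j
    simp [Finset.sum_apply, Pi.single_apply]
  conv_rhs => rw [← add_zero a, ← zero_add b, lin_add, ← h a, ← h b,
    ← Finset.sum_const_zero (ι := Fin d) (s := Finset.univ) (M := E d), lin_sum, lin_sum]
  rw [Fintype.sum_sum_type]
  congr 1
  · refine Finset.sum_congr rfl fun i _ => ?_
    rw [← smul_zero (a i), lin_smul]
    rfl
  · refine Finset.sum_congr rfl fun i _ => ?_
    rw [← smul_zero (b i), lin_smul]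
    rfl

theorem sum_coordOp_apply (a b : E d) (w : PhIdx d → ℝ) (hl : ∀ i, w (Sum.inl i) = a i)
    (hr : ∀ i, w (Sum.inr i) = b i) : ∑ k, (w k : ℂ) • coordOp k = lin a b := by
  rw [← sum_coordOp_eq_lin]
  refine Finset.sum_congr rfl fun k _ => ?_
  rcases k with i | i <;> simp [hl, hr]

end

/-! ### The linear flow and the metaplectic property -/

/-- The coefficients of `β·y - α·η`. -/
def genCoeff {d : ℕ} (α β : E d) : PhIdx d → ℝ := Sum.elim (fun i => β i) (fun i => -α i)

/-- The Hamiltonian vector field of `(β·y - α·η)²`. -/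
def flowGen {d : ℕ} (α β : E d) : Matrix (PhIdx d) (PhIdx d) ℝ :=
  Matrix.vecMulVec (Sum.elim (fun i => -(2 * α i)) (fun i => -(2 * β i))) (genCoeff α β)

theorem flowPhi_eq {d : ℕ} (α β : E d) (t : ℝ) : flowPhi α β t = 1 + t • flowGen α β := by
  rw [flowPhi, ← Matrix.fromBlocks_one]
  ext i j
  rcases i with i | i <;> rcases j with j | j <;>
    simp [flowGen, genCoeff, Matrix.vecMulVec_apply, Matrix.one_apply] <;> ring

/-- The linear form `β·y - α·η` Poisson commutes with itself, so the generator is nilpotent and the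
flow is affine in `t`. -/
theorem flowGen_mul_self {d : ℕ} (α β : E d) : flowGen α β * flowGen α β = 0 := by
  rw [flowGen, Matrix.vecMulVec_mul_vecMulVec]
  have : genCoeff α β ⬝ᵥ Sum.elim (fun i => -(2 * α i)) (fun i => -(2 * β i)) = 0 := by
    simp only [genCoeff, dotProduct, Fintype.sum_sum_type, Sum.elim_inl, Sum.elim_inr]
    rw [← Finset.sum_add_distrib]
    exact Finset.sum_eq_zero fun i _ => by ring
  rw [this, zero_smul, Matrix.vecMulVec_zero]

theorem symplJ_mul {d : ℕ} (α β : E d) :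
    symplJ d * ((2 : ℝ) • Matrix.vecMulVec (genCoeff α β) (genCoeff α β)) = flowGen α β := by
  rw [Matrix.mul_smul, Matrix.mul_vecMulVec, flowGen, ← Matrix.smul_vecMulVec]
  congr 1
  ext i
  rcases i with i | i <;> simp [symplJ, genCoeff, Matrix.fromBlocks_mulVec, Matrix.neg_mulVec]

theorem quadSymbol_eq {d : ℕ} (α β : E d) :
    quadSymbol ((2 : ℝ) • Matrix.vecMulVec (genCoeff α β) (genCoeff α β)) =
      polySymbol (linPoly (genCoeff α β) * (linPoly (genCoeff α β) * 1)) := by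
  funext z
  simp only [quadSymbol, polySymbol, map_mul, eval_linPoly, mul_one]
  rw [← Complex.ofReal_mul, Matrix.smul_mulVec, Matrix.vecMulVec_mulVec, smul_dotProduct]
  simp

/-- The symmetrized product of an operator with itself is its square. The trailing factor `1` lets
`linPoly_mul` be applied twice starting from `isWeyl_one`. -/
theorem isWeyl_sq {d : ℕ} (α β : E d) :
    IsWeyl (linPoly (genCoeff α β) * (linPoly (genCoeff α β) * 1))
      (lin β (-α) ∘ₗ lin β (-α)) := by
  have h := ((isWeyl_one (d := d)).linPoly_mul (genCoeff α β)).linPoly_mul (genCoeff α β)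
  rw [sum_coordOp_apply β (-α) _ (fun _ => rfl) (fun _ => rfl)] at h
  convert h using 1
  ext1 f
  simp only [jordan_apply, LinearMap.comp_apply, LinearMap.id_apply, map_smul, map_add]
  module

namespace Diagonalizes

variable {d : ℕ} {α β β' : E d} {V : 𝓢(E d, ℂ) ≃ₗ[ℂ] 𝓢(E d, ℂ)}

theorem isMetaplectic (hV : Diagonalizes α β β' V) (t : ℝ) :
    IsMetaplectic (hV.unitary t) (flowPhi α β t) := by
  refine ⟨fun _ => (2 : ℝ) • Matrix.vecMulVec (genCoeff α β) (genCoeff α β), flowPhi α β,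
    hV.unitary, 0, t, fun _ => ?_, fun _ _ => contDiff_const, ?_, fun t i j => ?_, fun φ =>
    ⟨fun t => propagator β' V t φ, propagator_zero φ, fun t => ⟨hV.unitary_toL2 t φ,
      toL2 (lin β (-α) (lin β (-α) (propagator β' V t φ))), ?_, hV.hasDerivAt_propagator φ t⟩⟩,
    rfl, rfl⟩
  · rw [Matrix.IsSymm, Matrix.transpose_smul, Matrix.transpose_vecMulVec]
  · rw [flowPhi_eq, zero_smul, add_zero]
  · rw [symplJ_mul, flowPhi_eq, mul_add, mul_one, Matrix.mul_smul, flowGen_mul_self, smul_zero,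
      add_zero]
    simp only [flowPhi_eq, Matrix.add_apply, Matrix.smul_apply, smul_eq_mul]
    simpa using ((hasDerivAt_id t).mul_const (flowGen α β i j)).const_add
      ((1 : Matrix (PhIdx d) (PhIdx d) ℝ) i j)
  · refine (SchwartzMap.coeFn_toLp _ 2 volume).trans (.of_forall fun x => ?_)
    rw [quadSymbol_eq, (isWeyl_sq α β).weylOp_eq]
    rfl

/-- The propagator conjugates the coordinates by the linear flow. -/
theorem propagator_comp_coordOp (hV : Diagonalizes α β β' V) (t : ℝ) (i : PhIdx d) :
    (propagator β' V t).toLinearMap ∘ₗ coordOp i =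
      (∑ k, (flowPhi α β (-t) i k : ℂ) • coordOp k) ∘ₗ (propagator β' V t).toLinearMap := by
  have h : ∀ (a b : E d) (r : ℝ), r = 2 * t * (inner ℝ a α + inner ℝ b β) →
      (propagator β' V t).toLinearMap ∘ₗ lin a b =
        lin (a + r • β) (b + r • -α) ∘ₗ (propagator β' V t).toLinearMap := fun a b r hr => by
    ext1 φ
    rw [lin_add, lin_smul, hr]
    exact hV.propagator_lin a b t φ
  rcases i with j | j
  · rw [sum_coordOp_apply (EuclideanSpace.single j 1 + (2 * t * α j) • β)
      (0 + (2 * t * α j) • -α)]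
    · exact h _ _ _ (by simp [EuclideanSpace.inner_single_left])
    · intro k
      simp [flowPhi, Matrix.vecMulVec_apply, Matrix.one_apply, eq_comm]
      ring
    · intro k
      simp [flowPhi, Matrix.vecMulVec_apply]
      ring
  · rw [sum_coordOp_apply (0 + (2 * t * β j) • β)
      (EuclideanSpace.single j 1 + (2 * t * β j) • -α)]
    · exact h _ _ _ (by simp [EuclideanSpace.inner_single_left])
    · intro k
      simp [flowPhi, Matrix.vecMulVec_apply]
      ring
    · intro k
      simp [flowPhi, Matrix.vecMulVec_apply, Matrix.one_apply, eq_comm]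
      ring

theorem propagator_isWeyl (hV : Diagonalizes α β β' V) (t : ℝ) {p : MvPolynomial (PhIdx d) ℂ}
    {A B : 𝓢(E d, ℂ) →ₗ[ℂ] 𝓢(E d, ℂ)} (hA : IsWeyl p A)
    (hB : IsWeyl (linSubst (flowPhi α β (-t)) p) B) (φ : 𝓢(E d, ℂ)) :
    propagator β' V t (A φ) = B (propagator β' V t φ) :=
  LinearMap.congr_fun (IsWeyl.map_apply (hV.propagator_comp_coordOp t) hA hB) φ

end Diagonalizes

/-! ### The action on the Siegel half-space -/

theorem dotProduct_toC_toC {d : ℕ} (x y : E d) :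
    dotProduct (toC x) (toC y) = ((inner ℝ x y : ℝ) : ℂ) := by
  simp [dotProduct, toC, PiLp.inner_apply, mul_comm]

theorem star_toC {d : ℕ} (x : E d) : star (toC x) = toC x := by
  funext i; simp [toC]

theorem Siegel.sub_conjTranspose {d : ℕ} {Γ : Matrix (Fin d) (Fin d) ℂ} (h : Γ.IsSymm) :
    Γ - Γ.conjTranspose = (2 * Complex.I) • (Γ.map Complex.im).map Complex.ofReal := by
  ext i j
  have : Γ j i = Γ i j := h.apply i j
  simp only [Matrix.sub_apply, Matrix.conjTranspose_apply, this, Matrix.smul_apply,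
    Matrix.map_apply, smul_eq_mul]
  apply Complex.ext <;> simp; ring

theorem im_dotProduct_mulVec_toC {d : ℕ} (Γ : Matrix (Fin d) (Fin d) ℂ) (x : E d) :
    (dotProduct (toC x) (Γ.mulVec (toC x))).im =
      dotProduct x.ofLp ((Γ.map Complex.im).mulVec x.ofLp) := by
  simp [dotProduct, Matrix.mulVec, toC, Complex.im_sum]

theorem widthDenom_im {d : ℕ} (μ : ℝ) (α β : E d) (Γ : Matrix (Fin d) (Fin d) ℂ) :
    (widthDenom μ α β Γ).im = dotProduct α.ofLp ((Γ.map Complex.im).mulVec α.ofLp) := by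
  rw [widthDenom, Complex.add_im, im_dotProduct_mulVec_toC, dotProduct_toC_toC]
  simp

theorem posDef_dotProduct_pos {d : ℕ} {P : Matrix (Fin d) (Fin d) ℝ} (hP : P.PosDef) {x : E d}
    (hx : x ≠ 0) : 0 < dotProduct x.ofLp (P.mulVec x.ofLp) := by
  have := hP.dotProduct_mulVec_pos (x := x.ofLp) (by simpa using hx)
  simpa using this

theorem widthDenom_im_pos {d : ℕ} (μ : ℝ) {α : E d} (hα : α ≠ 0) (β : E d)
    {Γ : Matrix (Fin d) (Fin d) ℂ} (h : Siegel Γ) : 0 < (widthDenom μ α β Γ).im := by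
  rw [widthDenom_im]; exact posDef_dotProduct_pos h.2 hα

theorem widthDenom_zero {d : ℕ} (μ : ℝ) (β : E d) (Γ : Matrix (Fin d) (Fin d) ℂ) :
    widthDenom μ 0 β Γ = 2 * μ := by
  have : toC (0 : E d) = 0 := by funext i; simp [toC]
  simp [widthDenom, this]

theorem widthDenom_ne_zero {d : ℕ} {μ : ℝ} (hμ : μ ≠ 0) (α β : E d)
    {Γ : Matrix (Fin d) (Fin d) ℂ} (h : Siegel Γ) : widthDenom μ α β Γ ≠ 0 := by
  by_cases hα : α = 0
  · subst hα
    rw [widthDenom_zero]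
    simpa using hμ
  · intro h0
    have := widthDenom_im_pos μ hα β h
    simp [h0] at this

/-- The vector `β - Γα`. -/
def shiftVec {d : ℕ} (α β : E d) (Γ : Matrix (Fin d) (Fin d) ℂ) : Fin d → ℂ :=
  toC β - Γ.mulVec (toC α)

/-- The matrix intertwining the imaginary parts of `Γ` and of its image. -/
def intertwiner {d : ℕ} (μ : ℝ) (α β : E d) (Γ : Matrix (Fin d) (Fin d) ℂ) :
    Matrix (Fin d) (Fin d) ℂ :=
  1 - (2 * (μ : ℂ))⁻¹ • Matrix.vecMulVec (toC α) (shiftVec α β Γ)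

theorem dotProduct_shiftVec {d : ℕ} (μ : ℝ) (α β : E d) (Γ : Matrix (Fin d) (Fin d) ℂ) :
    dotProduct (shiftVec α β Γ) (toC α) = 2 * μ - widthDenom μ α β Γ := by
  rw [shiftVec, sub_dotProduct, widthDenom, dotProduct_comm, dotProduct_comm _ (toC α)]
  ring

theorem det_intertwiner {d : ℕ} {μ : ℝ} (hμ : μ ≠ 0) (α β : E d)
    (Γ : Matrix (Fin d) (Fin d) ℂ) :
    (intertwiner μ α β Γ).det = widthDenom μ α β Γ / (2 * μ) := by
  have hm : (μ : ℂ) ≠ 0 := by exact_mod_cast hμ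
  have h := Matrix.det_one_add_replicateCol_mul_replicateRow (ι := Unit)
    (-(2 * (μ : ℂ))⁻¹ • toC α) (shiftVec α β Γ)
  rw [← Matrix.vecMulVec_eq, Matrix.smul_vecMulVec, neg_smul, ← sub_eq_add_neg, dotProduct_smul,
    dotProduct_shiftVec μ] at h
  rw [intertwiner, h, smul_eq_mul]
  field_simp
  ring

/-- For symmetric `Γ`, `Φ(1/(4μ))` applied to the block column `(1, Γ)` has upper block the
intertwiner and lower block the right-hand side. The new width is thus the fractional linear image
of `Γ`. -/
theorem newWidth_mul_intertwiner {d : ℕ} {μ : ℝ} (hμ : μ ≠ 0) (α β : E d)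
    (Γ : Matrix (Fin d) (Fin d) ℂ) (hD : widthDenom μ α β Γ ≠ 0) :
    newWidth μ α β Γ * intertwiner μ α β Γ =
      Γ - (2 * (μ : ℂ))⁻¹ • Matrix.vecMulVec (toC β) (shiftVec α β Γ) := by
  have hm : (μ : ℂ) ≠ 0 := by exact_mod_cast hμ
  have e : toC β = shiftVec α β Γ + Γ.mulVec (toC α) := by simp [shiftVec]
  rw [newWidth, ← shiftVec, intertwiner, e, Matrix.add_vecMulVec]
  rw [mul_sub, mul_one, sub_mul, Matrix.mul_smul, Matrix.mul_smul, Matrix.smul_mul,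
    Matrix.mul_vecMulVec, Matrix.vecMulVec_mul_vecMulVec, dotProduct_shiftVec μ]
  ext i j
  simp only [Matrix.sub_apply, Matrix.smul_apply, Matrix.add_apply, Matrix.vecMulVec_apply,
    smul_eq_mul, Pi.smul_apply]
  field_simp
  ring

theorem exists_isHermitian_intertwiner {d : ℕ} {μ : ℝ} (hμ : μ ≠ 0) (α β : E d)
    {Γ : Matrix (Fin d) (Fin d) ℂ} (hΓ : Γ.IsSymm) (hD : widthDenom μ α β Γ ≠ 0) :
    ∃ H : Matrix (Fin d) (Fin d) ℂ, H.IsHermitian ∧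
      (intertwiner μ α β Γ).conjTranspose * newWidth μ α β Γ * intertwiner μ α β Γ = Γ - H := by
  set v := shiftVec α β Γ with hv
  set m : ℂ := (2 * (μ : ℂ))⁻¹ with hm
  have hms : star m = m := by simp [hm]
  have hr : star (inner ℝ α β : ℂ) = (inner ℝ α β : ℂ) := Complex.conj_ofReal _
  refine ⟨m • Matrix.vecMulVec (toC β) v + m • Matrix.vecMulVec (star v) (toC β) -
    (m + m ^ 2 * (inner ℝ α β : ℂ)) • Matrix.vecMulVec (star v) v, ?_, ?_⟩
  · rw [Matrix.IsHermitian]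
    simp only [Matrix.conjTranspose_sub, Matrix.conjTranspose_add, Matrix.conjTranspose_smul,
      Matrix.conjTranspose_vecMulVec, star_star, star_toC, hms, star_add, star_mul', star_pow, hr]
    abel
  · have hvm : Matrix.vecMul (toC α) Γ = toC β - v := by
      rw [← Matrix.mulVec_transpose, hΓ.eq, hv, shiftVec]
      abel
    rw [mul_assoc, newWidth_mul_intertwiner hμ α β Γ hD, intertwiner]
    simp only [Matrix.conjTranspose_sub, Matrix.conjTranspose_one, Matrix.conjTranspose_smul,
      Matrix.conjTranspose_vecMulVec, star_toC]
    rw [← hv, ← hm, hms, sub_mul, one_mul, mul_sub, Matrix.smul_mul, Matrix.vecMulVec_mul, hvm,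
      Matrix.mul_smul, Matrix.smul_mul, Matrix.vecMulVec_mul_vecMulVec, dotProduct_toC_toC]
    ext i j
    simp only [Matrix.sub_apply, Matrix.smul_apply, Matrix.add_apply, Matrix.vecMulVec_apply,
      smul_eq_mul, Pi.smul_apply, Pi.sub_apply]
    ring

theorem newWidth_isSymm {d : ℕ} (μ : ℝ) (α β : E d) {Γ : Matrix (Fin d) (Fin d) ℂ}
    (hΓ : Γ.IsSymm) : (newWidth μ α β Γ).IsSymm := by
  apply Matrix.IsSymm.ext
  intro i j
  simp [newWidth, hΓ.apply i j, Matrix.vecMulVec_apply, mul_comm]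

/-- Subtracting from `N* Γ' N = Γ - H` its conjugate transpose removes the Hermitian `H`; for
symmetric matrices what remains is `2i` times the imaginary parts. -/
theorem conj_im_newWidth {d : ℕ} {μ : ℝ} (hμ : μ ≠ 0) (α β : E d)
    {Γ : Matrix (Fin d) (Fin d) ℂ} (hΓ : Γ.IsSymm) (hD : widthDenom μ α β Γ ≠ 0) :
    (intertwiner μ α β Γ).conjTranspose *
        ((newWidth μ α β Γ).map Complex.im).map Complex.ofReal * intertwiner μ α β Γ =
      (Γ.map Complex.im).map Complex.ofReal := by
  obtain ⟨H, hH, h⟩ := exists_isHermitian_intertwiner hμ α β hΓ hD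
  have h' := congrArg Matrix.conjTranspose h
  rw [Matrix.conjTranspose_mul, Matrix.conjTranspose_mul, Matrix.conjTranspose_conjTranspose,
    Matrix.conjTranspose_sub, hH.eq, ← mul_assoc] at h'
  have h2 : (2 * Complex.I) ≠ 0 := by simp
  refine smul_right_injective _ h2 ?_
  show _ = (2 * Complex.I) • _
  dsimp only
  rw [← Siegel.sub_conjTranspose hΓ, ← Matrix.smul_mul, ← Matrix.mul_smul,
    ← Siegel.sub_conjTranspose (newWidth_isSymm μ α β hΓ), mul_sub, sub_mul, h, h']
  abel

/-- The intertwiner is complex, so positivity of the real matrix is needed on complex vectors; real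
and imaginary parts contribute separately. -/
theorem posDef_map_ofReal {d : ℕ} {P : Matrix (Fin d) (Fin d) ℝ} (hP : P.PosDef)
    {z : Fin d → ℂ} (hz : z ≠ 0) :
    0 < (dotProduct (star z) ((P.map Complex.ofReal).mulVec z)).re := by
  have e : (dotProduct (star z) ((P.map Complex.ofReal).mulVec z)).re =
      dotProduct (fun i => (z i).re) (P.mulVec fun i => (z i).re) +
      dotProduct (fun i => (z i).im) (P.mulVec fun i => (z i).im) := by
    simp only [dotProduct, Matrix.mulVec, Complex.re_sum, Finset.mul_sum, ← Finset.sum_add_distrib]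
    refine Finset.sum_congr rfl fun i _ => Finset.sum_congr rfl fun j _ => ?_
    simp
  have hnn : ∀ x : Fin d → ℝ, 0 ≤ dotProduct x (P.mulVec x) := fun x => by
    simpa using hP.posSemidef.dotProduct_mulVec_nonneg x
  have hpos : ∀ x : Fin d → ℝ, x ≠ 0 → 0 < dotProduct x (P.mulVec x) := fun x hx => by
    simpa using hP.dotProduct_mulVec_pos hx
  rw [e]
  by_cases h : (fun i => (z i).re) = 0
  · have h' : (fun i => (z i).im) ≠ 0 := fun h' => hz <| funext fun i =>
      Complex.ext (congrFun h i) (congrFun h' i)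
    exact add_pos_of_nonneg_of_pos (hnn _) (hpos _ h')
  · exact add_pos_of_pos_of_nonneg (hpos _ h) (hnn _)

theorem siegel_newWidth {d : ℕ} {μ : ℝ} (hμ : μ ≠ 0) (α β : E d)
    {Γ : Matrix (Fin d) (Fin d) ℂ} (h : Siegel Γ) : Siegel (newWidth μ α β Γ) := by
  have hD := widthDenom_ne_zero hμ α β h
  have hm : (μ : ℂ) ≠ 0 := by exact_mod_cast hμ
  have hs := newWidth_isSymm μ α β h.1
  have hu : IsUnit (intertwiner μ α β Γ).det := by
    rw [det_intertwiner hμ, isUnit_iff_ne_zero]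
    simp [hD, hm]
  refine ⟨hs, Matrix.PosDef.of_dotProduct_mulVec_pos ?_ fun x hx => ?_⟩
  · refine Matrix.IsHermitian.ext fun i j => ?_
    simp only [Matrix.map_apply, hs.apply i j, star_trivial]
  · set N := intertwiner μ α β Γ
    set Q := (newWidth μ α β Γ).map Complex.im
    set z := N⁻¹.mulVec (fun i => (x i : ℂ)) with hz
    have hNz : N.mulVec z = fun i => (x i : ℂ) := by
      rw [hz, Matrix.mulVec_mulVec, Matrix.mul_nonsing_inv _ hu, Matrix.one_mulVec]
    have hz0 : z ≠ 0 := by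
      intro h0
      rw [h0, Matrix.mulVec_zero] at hNz
      refine hx (funext fun i => ?_)
      have := congrFun hNz i
      simpa using this.symm
    have := posDef_map_ofReal h.2 hz0
    rw [← conj_im_newWidth hμ α β h.1 hD, ← Matrix.mulVec_mulVec, ← Matrix.mulVec_mulVec,
      Matrix.dotProduct_mulVec, ← Matrix.star_mulVec, hNz] at this
    refine this.trans_eq ?_
    simp [Q, dotProduct, Matrix.mulVec, Complex.re_sum]

theorem det_im_eq {d : ℕ} {μ : ℝ} (hμ : μ ≠ 0) (α β : E d)
    {Γ : Matrix (Fin d) (Fin d) ℂ} (h : Siegel Γ) :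
    (Γ.map Complex.im).det =
      ‖widthDenom μ α β Γ / (2 * μ)‖ ^ 2 * ((newWidth μ α β Γ).map Complex.im).det := by
  have e := congrArg Matrix.det (conj_im_newWidth hμ α β h.1 (widthDenom_ne_zero hμ α β h))
  have hdet : ∀ P : Matrix (Fin d) (Fin d) ℝ, (P.map Complex.ofReal).det = (P.det : ℂ) :=
    fun P => (RingHom.map_det Complex.ofRealHom P).symm
  rw [Matrix.det_mul, Matrix.det_mul, hdet, hdet, Matrix.det_conjTranspose,
    det_intertwiner hμ] at e
  have e2 := Complex.conj_mul' (widthDenom μ α β Γ / (2 * μ))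
  apply Complex.ofReal_injective
  rw [← e]
  push_cast
  rw [← e2, Complex.star_def]
  ring

theorem isNormConst_newWidth {d : ℕ} {μ : ℝ} (hμ : μ ≠ 0) (α β : E d)
    {Γ : Matrix (Fin d) (Fin d) ℂ} (h : Siegel Γ) {c : ℂ} (hc : IsNormConst c Γ) :
    IsNormConst (c * (widthDenom μ α β Γ / (2 * μ)) ^ (-(1 / 2) : ℂ)) (newWidth μ α β Γ) := by
  have hm : (μ : ℂ) ≠ 0 := by exact_mod_cast hμ
  have hD := widthDenom_ne_zero hμ α β h
  set w := widthDenom μ α β Γ / (2 * μ) with hw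
  have hw0 : w ≠ 0 := by simp [hw, hD, hm]
  have hn : 0 < ‖w‖ := norm_pos_iff.2 hw0
  have hexp : (-(1 / 2) : ℂ) = ((-(1 / 2) : ℝ) : ℂ) := by push_cast; ring
  rw [IsNormConst] at hc ⊢
  rw [norm_mul, hc, det_im_eq hμ α β h, ← hw, hexp, Complex.norm_cpow_real,
    Real.mul_rpow (by positivity) (siegel_newWidth hμ α β h).2.det_pos.le, ← Real.rpow_natCast,
    ← Real.rpow_mul hn.le]
  -- The factor `‖w‖²` in the determinant, raised to the power `1/4`, cancels the modulus of
  -- `w^{-1/2}`.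
  have : ‖w‖ ^ (((2 : ℕ) : ℝ) * (1 / 4)) * ‖w‖ ^ (-(1 / 2) : ℝ) = 1 := by
    rw [← Real.rpow_add hn]
    norm_num
  linear_combination (Real.pi ^ (-(d : ℝ) / 4) *
    ((newWidth μ α β Γ).map Complex.im).det ^ (1 / 4 : ℝ)) * this

/-! ### Gaussians -/

theorem hasTemperateGrowth_quadratic {d : ℕ} (Γ : Matrix (Fin d) (Fin d) ℂ) :
    (fun x : E d => Complex.I / 2 * dotProduct (Γ.mulVec (toC x)) (toC x)).HasTemperateGrowth := by
  have hc : ∀ i : Fin d, (fun x : E d => ((x i : ℝ) : ℂ)).HasTemperateGrowth := fun i =>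
    (Complex.ofRealCLM.comp (EuclideanSpace.proj (𝕜 := ℝ) i)).hasTemperateGrowth
  simp only [dotProduct, Matrix.mulVec, toC]
  refine (Function.HasTemperateGrowth.const _).mul (.sum fun i _ => ?_)
  exact .mul (.sum fun j _ => (Function.HasTemperateGrowth.const _).mul (hc j)) (hc i)

theorem re_quadratic {d : ℕ} (Γ : Matrix (Fin d) (Fin d) ℂ) (x : E d) :
    (Complex.I / 2 * dotProduct (Γ.mulVec (toC x)) (toC x)).re =
      -(dotProduct x.ofLp ((Γ.map Complex.im).mulVec x.ofLp) / 2) := by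
  rw [dotProduct_comm, ← im_dotProduct_mulVec_toC]
  simp
  ring

theorem exists_quadratic_ge {d : ℕ} {P : Matrix (Fin d) (Fin d) ℝ} (hP : P.PosDef) :
    ∃ r : ℝ, 0 < r ∧ ∀ x : E d, r * ‖x‖ ^ 2 ≤ dotProduct x.ofLp (P.mulVec x.ofLp) := by
  have hcont : Continuous fun x : E d => dotProduct x.ofLp (P.mulVec x.ofLp) := by
    simp only [dotProduct, Matrix.mulVec]
    fun_prop
  obtain ⟨r, hr, h⟩ : ∃ r : ℝ, 0 < r ∧ ∀ x ∈ Metric.sphere (0 : E d) 1,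
      r ≤ dotProduct x.ofLp (P.mulVec x.ofLp) := by
    rcases (Metric.sphere (0 : E d) 1).eq_empty_or_nonempty with he | hne
    -- The sphere is empty in dimension zero, where any positive constant will do.
    · exact ⟨1, one_pos, by simp [he]⟩
    · obtain ⟨x, hx, hmin⟩ := (isCompact_sphere (0 : E d) 1).exists_isMinOn hne hcont.continuousOn
      exact ⟨_, posDef_dotProduct_pos hP (ne_zero_of_mem_unit_sphere ⟨x, hx⟩), hmin⟩
  refine ⟨r, hr, fun x => ?_⟩
  by_cases hx : x = 0
  · simp [hx]
  have hn : 0 < ‖x‖ := norm_pos_iff.2 hx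
  have h1 := h (‖x‖⁻¹ • x) (by simp [norm_smul, hn.ne'])
  rw [WithLp.ofLp_smul, Matrix.mulVec_smul, dotProduct_smul, smul_dotProduct, smul_eq_mul,
    smul_eq_mul, ← mul_assoc, ← sq, inv_pow, ← div_eq_inv_mul, le_div_iff₀ (by positivity)] at h1
  exact h1

theorem exists_gaussian {d : ℕ} (c : ℂ) {Γ : Matrix (Fin d) (Fin d) ℂ} (h : Siegel Γ) :
    ∃ g : 𝓢(E d, ℂ), (g : E d → ℂ) = gaussian c Γ := by
  obtain ⟨r, hr, hb⟩ := exists_quadratic_ge h.2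
  refine ⟨c • expSchwartz _ (hasTemperateGrowth_quadratic Γ) (r / 2) (by positivity) fun x => ?_, ?_⟩
  · rw [re_quadratic]
    linarith [hb x]
  · funext x
    simp [gaussian]

theorem toC_sub_smul {d : ℕ} (y α : E d) (s : ℝ) : toC (y - s • α) = toC y - (s : ℂ) • toC α := by
  funext i; simp [toC]

theorem dotProduct_mulVec_symm {d : ℕ} {Γ : Matrix (Fin d) (Fin d) ℂ} (hΓ : Γ.IsSymm)
    (u v : Fin d → ℂ) : dotProduct (Γ.mulVec u) v = dotProduct (Γ.mulVec v) u := by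
  rw [dotProduct_comm, Matrix.dotProduct_mulVec, ← Matrix.mulVec_transpose, hΓ.eq]

/-- As a function of `s` the exponent is a quadratic polynomial with leading coefficient `(i/2)(2μ -
α·β + α·Γα)` and linear coefficient `i(β - Γα)·y`; both the denominator and the rank one correction
of the width arise here. -/
theorem expLin_gaussian {d : ℕ} (μ : ℝ) (α β : E d) {Γ : Matrix (Fin d) (Fin d) ℂ}
    (hΓ : Γ.IsSymm) (c : ℂ) (y : E d) (s : ℝ) :
    Complex.exp (Complex.I * ((μ * s ^ 2 : ℝ) : ℂ)) * expLin α β s (gaussian c Γ) y =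
      c * Complex.exp (Complex.I / 2 * widthDenom μ α β Γ * (s : ℂ) ^ 2 +
        Complex.I * dotProduct (shiftVec α β Γ) (toC y) * s +
        Complex.I / 2 * dotProduct (Γ.mulVec (toC y)) (toC y)) := by
  have hv : dotProduct (shiftVec α β Γ) (toC y) =
      (inner ℝ β y : ℝ) - dotProduct (Γ.mulVec (toC α)) (toC y) := by
    rw [shiftVec, sub_dotProduct, dotProduct_toC_toC]
  have hq : dotProduct (Γ.mulVec (toC (y - s • α))) (toC (y - s • α)) =
      dotProduct (Γ.mulVec (toC y)) (toC y) - 2 * s * dotProduct (Γ.mulVec (toC α)) (toC y) +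
        (s : ℂ) ^ 2 * dotProduct (Γ.mulVec (toC α)) (toC α) := by
    rw [toC_sub_smul, Matrix.mulVec_sub, Matrix.mulVec_smul, sub_dotProduct, dotProduct_sub,
      dotProduct_sub, smul_dotProduct, smul_dotProduct, dotProduct_smul, dotProduct_smul,
      dotProduct_mulVec_symm hΓ (toC y) (toC α)]
    simp only [smul_eq_mul]
    ring
  rw [expLin, gaussian, hq, hv, widthDenom, dotProduct_toC_toC, dotProduct_comm (toC α)]
  rw [mul_left_comm _ c, mul_left_comm _ c, ← Complex.exp_add, ← Complex.exp_add,
    ← Complex.exp_add]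
  congr 2
  push_cast
  ring

theorem gaussian_newWidth {d : ℕ} (μ : ℝ) (α β : E d) (Γ : Matrix (Fin d) (Fin d) ℂ)
    (c : ℂ) (y : E d) :
    gaussian c (newWidth μ α β Γ) y =
      c * Complex.exp (Complex.I / 2 * (dotProduct (Γ.mulVec (toC y)) (toC y) -
        (widthDenom μ α β Γ)⁻¹ * dotProduct (shiftVec α β Γ) (toC y) ^ 2)) := by
  rw [gaussian, newWidth, ← shiftVec, Matrix.sub_mulVec, Matrix.smul_mulVec,
    Matrix.vecMulVec_mulVec, sub_dotProduct, smul_dotProduct]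
  congr 4
  simp [sq]

/-- Principal roots multiply because the arguments do not overflow: `iπ/μ` has argument `±π/2`, and
`(D/(2μ))⁻¹` lies in the opposite half-plane since `Im D > 0`. -/
theorem fresnelConst_mul_cpow {μ : ℝ} (hμ : μ ≠ 0) {D : ℂ} (hD : 0 < D.im) :
    (Real.pi / -(Complex.I / 2 * D)) ^ (1 / 2 : ℂ) =
      fresnelConst μ * (D / (2 * μ)) ^ (-(1 / 2) : ℂ) := by
  have hm : (μ : ℂ) ≠ 0 := by exact_mod_cast hμ
  have hpi : (Real.pi : ℂ) ≠ 0 := by exact_mod_cast Real.pi_ne_zero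
  have hD0 : D ≠ 0 := fun h => by simp [h] at hD
  set w := D / (2 * (μ : ℂ)) with hw
  have hw0 : w ≠ 0 := div_ne_zero hD0 (by simpa using hm)
  have hwim : w.im = D.im / (2 * μ) := by
    have : w = D / ((2 * μ : ℝ) : ℂ) := by rw [hw]; push_cast; rfl
    rw [this, Complex.div_ofReal_im]
  have hx : Complex.I * Real.pi / μ = ((Real.pi / μ : ℝ) : ℂ) * Complex.I := by
    push_cast; ring
  have hx0 : Complex.I * Real.pi / μ ≠ 0 := by simp [hm, Real.pi_ne_zero]
  have hprod : Real.pi / -(Complex.I / 2 * D) = Complex.I * Real.pi / μ * w⁻¹ := by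
    have hI : Complex.I ≠ 0 := Complex.I_ne_zero
    rw [hw]
    field_simp
    rw [Complex.I_sq]
  have hwpi : w.arg ≠ Real.pi := by
    rw [Ne, Complex.arg_eq_pi_iff, hwim]
    exact fun h => (div_ne_zero hD.ne' (by simpa using hμ)) h.2
  have harg : (Complex.I * Real.pi / μ).arg + w⁻¹.arg ∈ Set.Ioc (-Real.pi) Real.pi := by
    have h1 := Complex.neg_pi_lt_arg w⁻¹
    have h2 := Complex.arg_le_pi w⁻¹
    have hpos := Real.pi_pos
    have hinv : w⁻¹.im = -w.im / Complex.normSq w := Complex.inv_im w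
    have hns : 0 < Complex.normSq w := Complex.normSq_pos.2 hw0
    rcases lt_or_gt_of_ne hμ with hneg | hpos'
    · have ha : (Complex.I * Real.pi / μ).arg = -(Real.pi / 2) := by
        rw [Complex.arg_eq_neg_pi_div_two_iff, hx]
        simpa using div_neg_of_pos_of_neg hpos hneg
      have hb : 0 ≤ w⁻¹.arg := by
        rw [Complex.arg_nonneg_iff, hinv, hwim]
        have : D.im / (2 * μ) < 0 := div_neg_of_pos_of_neg hD (by linarith)
        exact div_nonneg (by linarith) hns.le
      rw [ha]
      constructor <;> linarith
    · have ha : (Complex.I * Real.pi / μ).arg = Real.pi / 2 := by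
        rw [Complex.arg_eq_pi_div_two_iff, hx]
        simpa using div_pos hpos hpos'
      have hb : w⁻¹.arg < 0 := by
        rw [Complex.arg_neg_iff, hinv, hwim]
        have : 0 < D.im / (2 * μ) := div_pos hD (by linarith)
        exact div_neg_of_neg_of_pos (by linarith) hns
      rw [ha]
      constructor <;> linarith
  rw [hprod, fresnelConst, Complex.cpow_neg, ← Complex.inv_cpow _ _ hwpi,
    Complex.cpow_def_of_ne_zero (mul_ne_zero hx0 (inv_ne_zero hw0)),
    Complex.cpow_def_of_ne_zero hx0, Complex.cpow_def_of_ne_zero (inv_ne_zero hw0),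
    Complex.log_mul hx0 (inv_ne_zero hw0) harg, add_mul, Complex.exp_add]

/-- For `α ≠ 0` the denominator has positive imaginary part and the `s` integral is an absolutely
convergent Gaussian. For `α = 0` it is the real number `2μ`, the integral is only a Fresnel
integral, and the Gaussian is just multiplied by a phase. -/
theorem tendsto_transferTrunc_gaussian {d : ℕ} {μ : ℝ} (hμ : μ ≠ 0) (α β : E d)
    {Γ : Matrix (Fin d) (Fin d) ℂ} (h : Siegel Γ) (c : ℂ) (y : E d) :
    Tendsto (fun R => transferTrunc μ α β R (gaussian c Γ) y) atTop
      (𝓝 (fresnelConst μ * gaussian (c * (widthDenom μ α β Γ / (2 * μ)) ^ (-(1 / 2) : ℂ))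
        (newWidth μ α β Γ) y)) := by
  have hm : (μ : ℂ) ≠ 0 := by exact_mod_cast hμ
  by_cases hα : α = 0
  · subst hα
    have h0 : toC (0 : E d) = 0 := by funext i; simp [toC]
    have ht := (tendsto_fresnelTrunc hμ (inner ℝ β y)).const_mul (gaussian c Γ y)
    have e : gaussian c Γ y * (fresnelConst μ *
        Complex.exp (Complex.I * ((-(1 / (4 * μ) * inner ℝ β y ^ 2) : ℝ) : ℂ))) =
        fresnelConst μ * gaussian (c * (widthDenom μ 0 β Γ / (2 * μ)) ^ (-(1 / 2) : ℂ))
        (newWidth μ 0 β Γ) y := by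
      rw [gaussian_newWidth, widthDenom_zero, div_self (by simpa using hm), Complex.one_cpow,
        mul_one, shiftVec, h0, Matrix.mulVec_zero, sub_zero, dotProduct_toC_toC, gaussian,
        mul_left_comm, mul_assoc, ← Complex.exp_add]
      congr 3
      push_cast
      field_simp
      ring
    rw [← e]
    refine ht.congr fun R => ?_
    rw [transferTrunc, fresnelTrunc, ← intervalIntegral.integral_const_mul]
    refine intervalIntegral.integral_congr fun s _ => ?_
    simp [expLin]
    ring
  · have hD := widthDenom_im_pos μ hα β h
    have hb : (Complex.I / 2 * widthDenom μ α β Γ).re < 0 := by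
      have : (Complex.I / 2 * widthDenom μ α β Γ).re = -((widthDenom μ α β Γ).im / 2) := by
        simp
        ring
      rw [this]
      linarith
    have hD0 := widthDenom_ne_zero hμ α β h
    have hi := intervalIntegral_tendsto_integral
      (integrable_cexp_quadratic' hb (Complex.I * dotProduct (shiftVec α β Γ) (toC y))
        (Complex.I / 2 * dotProduct (Γ.mulVec (toC y)) (toC y)))
      tendsto_neg_atTop_atBot tendsto_id
    rw [integral_cexp_quadratic hb, fresnelConst_mul_cpow hμ hD] at hi
    have e := hi.const_mul c
    have e2 : c * (fresnelConst μ * (widthDenom μ α β Γ / (2 * μ)) ^ (-(1 / 2) : ℂ) *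
        Complex.exp (Complex.I / 2 * dotProduct (Γ.mulVec (toC y)) (toC y) -
          (Complex.I * dotProduct (shiftVec α β Γ) (toC y)) ^ 2 /
            (4 * (Complex.I / 2 * widthDenom μ α β Γ)))) =
        fresnelConst μ * gaussian (c * (widthDenom μ α β Γ / (2 * μ)) ^ (-(1 / 2) : ℂ))
        (newWidth μ α β Γ) y := by
      rw [gaussian_newWidth]
      have hI : Complex.I ≠ 0 := Complex.I_ne_zero
      have : Complex.I / 2 * dotProduct (Γ.mulVec (toC y)) (toC y) -
          (Complex.I * dotProduct (shiftVec α β Γ) (toC y)) ^ 2 /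
            (4 * (Complex.I / 2 * widthDenom μ α β Γ)) =
          Complex.I / 2 * (dotProduct (Γ.mulVec (toC y)) (toC y) -
        (widthDenom μ α β Γ)⁻¹ * dotProduct (shiftVec α β Γ) (toC y) ^ 2) := by
        field_simp
        ring
      rw [this]
      ring
    rw [← e2]
    refine e.congr fun R => ?_
    rw [transferTrunc, ← intervalIntegral.integral_const_mul]
    exact intervalIntegral.integral_congr fun s _ => (expLin_gaussian μ α β h.1 c y s).symm

/-- The same pointwise limit has been computed in two ways; the nonzero constant `√(iπ/μ)` cancels.
-/
theorem Diagonalizes.propagator_gaussian {d : ℕ} {α β β' : E d} {V : 𝓢(E d, ℂ) ≃ₗ[ℂ] 𝓢(E d, ℂ)}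
    (hV : Diagonalizes α β β' V) {μ : ℝ} (hμ : μ ≠ 0) {Γ : Matrix (Fin d) (Fin d) ℂ}
    (h : Siegel Γ) {c : ℂ} {g g' : 𝓢(E d, ℂ)} (hg : (g : E d → ℂ) = gaussian c Γ)
    (hg' : (g' : E d → ℂ) = gaussian (c * (widthDenom μ α β Γ / (2 * μ)) ^ (-(1 / 2) : ℂ))
      (newWidth μ α β Γ)) :
    propagator β' V (1 / (4 * μ)) g = g' := by
  ext y
  have h1 := hV.tendsto_transferTrunc hμ g y
  rw [hg] at h1
  have := tendsto_nhds_unique h1 (tendsto_transferTrunc_gaussian hμ α β h c y)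
  rw [← hg'] at this
  exact mul_left_cancel₀ (fresnelConst_ne_zero hμ) this

end TransferOp

end

/-! ### Assembly of the three statements. -/

theorem propositionE1 {d : ℕ} (μ : ℝ) (α β : TransferOp.E d) :
    -- (1) the operator maps the Schwartz space into itself iff `μ ≠ 0`
    (TransferOp.MapsSchwartz μ α β ↔ μ ≠ 0) ∧
    (μ ≠ 0 →
      -- (2) it is `√(iπ/μ) e^{-(i/4μ)(β·y - α·D_y)²}`, a scalar times a metaplectic operator
      (∃ U : ℝ → (TransferOp.L2 d ≃ₗᵢ[ℂ] TransferOp.L2 d),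
        TransferOp.IsUnitaryGroup
          (fun f => TransferOp.linOp α β (TransferOp.linOp α β f)) U ∧
        (∀ V : ℝ → (TransferOp.L2 d ≃ₗᵢ[ℂ] TransferOp.L2 d),
          TransferOp.IsUnitaryGroup
            (fun f => TransferOp.linOp α β (TransferOp.linOp α β f)) V → V = U) ∧
        TransferOp.IsMetaplectic (U (1 / (4 * μ))) (TransferOp.flowPhi α β (1 / (4 * μ))) ∧
        ∀ φ : 𝓢(TransferOp.E d, ℂ), ∃ ψ : 𝓢(TransferOp.E d, ℂ),
          TransferOp.IsTransfer μ α β φ ψ ∧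
          (∀ y, Tendsto (fun R : ℝ => TransferOp.transferTrunc μ α β R φ y) atTop (𝓝 (ψ y))) ∧
          TransferOp.toL2 ψ =
            TransferOp.fresnelConst μ • U (1 / (4 * μ)) (TransferOp.toL2 φ)) ∧
      -- (3) action on polynomials times Gaussians
      (∀ Γ : Matrix (Fin d) (Fin d) ℂ, TransferOp.Siegel Γ →
        TransferOp.widthDenom μ α β Γ ≠ 0 ∧
        TransferOp.Siegel (TransferOp.newWidth μ α β Γ) ∧
        ∀ c c' : ℂ, TransferOp.IsNormConst c Γ →
          c' = c * (TransferOp.widthDenom μ α β Γ / (2 * μ)) ^ (-(1 / 2) : ℂ) →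
          TransferOp.IsNormConst c' (TransferOp.newWidth μ α β Γ) ∧
          ∀ p : MvPolynomial (TransferOp.PhIdx d) ℂ, ∃ f ψ : 𝓢(TransferOp.E d, ℂ),
            (∀ x, f x = TransferOp.weylOp (TransferOp.polySymbol p)
              (TransferOp.gaussian c Γ) x) ∧
            (∀ x, ψ x = TransferOp.fresnelConst μ * TransferOp.weylOp
              (fun z => TransferOp.polySymbol p
                ((TransferOp.flowPhi α β (-(1 / (4 * μ)))).mulVec z))
              (TransferOp.gaussian c' (TransferOp.newWidth μ α β Γ)) x) ∧
            TransferOp.IsTransfer μ α β f ψ)) := by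
  obtain ⟨β', V, hV⟩ := TransferOp.exists_diagonalizes α β
  refine ⟨⟨?_, fun hμ => TransferOp.mapsSchwartz hμ α β⟩, fun hμ => ⟨?_, ?_⟩⟩
  · rintro h rfl
    exact TransferOp.not_mapsSchwartz_zero α β h
  · refine ⟨hV.unitary, hV.isUnitaryGroup, fun W hW => hV.eq_unitary hW,
      hV.isMetaplectic _, fun φ => ⟨TransferOp.fresnelConst μ •
        TransferOp.propagator β' V (1 / (4 * μ)) φ, hV.isTransfer hμ φ,
        hV.tendsto_transferTrunc hμ φ, ?_⟩⟩
    rw [TransferOp.toL2_smul, hV.unitary_toL2]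
  · intro Γ hΓ
    refine ⟨TransferOp.widthDenom_ne_zero hμ α β hΓ, TransferOp.siegel_newWidth hμ α β hΓ, ?_⟩
    rintro c _ hc rfl
    refine ⟨TransferOp.isNormConst_newWidth hμ α β hΓ hc, fun p => ?_⟩
    obtain ⟨g, hg⟩ := TransferOp.exists_gaussian c hΓ
    obtain ⟨g', hg'⟩ := TransferOp.exists_gaussian
      (c * (TransferOp.widthDenom μ α β Γ / (2 * μ)) ^ (-(1 / 2) : ℂ))
      (TransferOp.siegel_newWidth hμ α β hΓ)
    obtain ⟨A, hA⟩ := TransferOp.exists_isWeyl p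
    obtain ⟨B, hB⟩ := TransferOp.exists_isWeyl
      (TransferOp.linSubst (TransferOp.flowPhi α β (-(1 / (4 * μ)))) p)
    refine ⟨A g, TransferOp.fresnelConst μ • TransferOp.propagator β' V (1 / (4 * μ)) (A g),
      fun x => ?_, fun x => ?_, hV.isTransfer hμ (A g)⟩
    · rw [← hg, hA.weylOp_eq]
    -- Covariance moves the propagator through the quantized polynomial, and its action on the
    -- Gaussian finishes the computation.
    · rw [hV.propagator_isWeyl _ hA hB, hV.propagator_gaussian hμ hΓ hg hg', ← hg',
        ← funext (TransferOp.polySymbol_linSubst _ p), hB.weylOp_eq]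
      rfl
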